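/- **Proposition (operator-valued Calderón–Vaillancourt).** Let $n\in\mathbb N$ and $k_n=\lfloor n/2\rfloor+2$. There is a constant $C>0$, depending only on $n$, such that the following holds. Let $\mathbf H$ be a separable complex Hilbert space, let $\mathscr L(\mathbf H)$ be the space of bounded linear operators on $\mathbf H$ with the operator norm, and let $\mathrm L:\mathbb R^n\times\mathbb R^n\to\mathscr L(\mathbf H)$, $(y,\eta)\mapsto \mathrm L(y,\eta)$, be a symbol whose classical (operator-norm) derivatives $\partial_y^\alpha\partial_\eta^\beta\mathrm L$ exist everywhere for all multi-indices $\alpha,\beta\in\mathbb N^n$ with $|\alpha|,|\beta|\le k_n$ and satisfy $$ \|\mathrm L\|_{k_n}:=\sup_{|\alpha|,|\beta|\le k_n}\ \sup_{y,\eta\in\mathbb R^n}\big\|\partial_y^\alpha\partial_\eta^\beta \mathrm L(y,\eta)\big\|_{\mathscr L(\mathbf H)}<+\infty . $$ For $u\in\mathscr S(\mathbb R^n;\mathbf H)$ put $\widehat u(\eta)=\int_{\mathbb R^n}e^{-i\eta\cdot y}u(y)\,dy$ and $$ \operatorname{Op}_{\mathrm L}u(y)=(2\pi)^{-n}\int_{\mathbb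 R^n}e^{iy\cdot\eta}\,\mathrm L(y,\eta)\,\widehat u(\eta)\,d\eta ,\qquad y\in\mathbb R^n . $$ Then this integral converges absolutely for every $u\in\mathscr S(\mathbb R^n;\mathbf H)$ and every $y\in\mathbb R^n$, and $\operatorname{Op}_{\mathrm L}$ extends to a bounded linear operator on $L^2(\mathbb R^n;\mathbf H)$ with $$ \|\operatorname{Op}_{\mathrm L}\|_{\mathscr L(L^2(\mathbb R^n;\mathbf H))}\le C\,\|\mathrm L\|_{k_n}. $$ -/

import Mathlib

open MeasureTheory TopologicalSpace
open scoped SchwartzMap ENNReal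

noncomputable section

namespace OpSymbol

/-- Euclidean space `ℝⁿ`. -/
abbrev Eucl (n : ℕ) : Type := EuclideanSpace ℝ (Fin n)

section Derivatives

variable {n : ℕ} {F : Type*} [NormedAddCommGroup F] [NormedSpace ℝ F]

/-- Iterated partial derivative `∂_{i₁} ∂_{i₂} ⋯ ∂_{iₘ} f` along a list `[i₁, …, iₘ]` of
coordinates; the last coordinate of the list is differentiated first. -/
def iterPartial : List (Fin n) → (Eucl n → F) → Eucl n → F
  | [], f => f
  | i :: l, f => fun x => lineDeriv ℝ (iterPartial l f) x (EuclideanSpace.single i 1)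

/-- All the derivatives formed in the definition of `iterPartial l f` exist, everywhere. -/
def IterPartialExists : List (Fin n) → (Eucl n → F) → Prop
  | [], _ => True
  | i :: l, f => IterPartialExists l f ∧
      ∀ x, LineDifferentiableAt ℝ (iterPartial l f) x (EuclideanSpace.single i 1)

/-- The coordinates of the multi-index `α`, each repeated `α i` times, in increasing order. -/
def word (α : Fin n → ℕ) : List (Fin n) :=
  (List.ofFn fun i => List.replicate (α i) i).flatten

/-- The length `|α|` of a multi-index. -/
def order (α : Fin n → ℕ) : ℕ := ∑ i, α i

/-- `∂^α f = ∂₁^{α₁} ⋯ ∂ₙ^{αₙ} f`. -/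
def multiPartial (α : Fin n → ℕ) (f : Eucl n → F) : Eucl n → F := iterPartial (word α) f

/-- The classical derivative `∂^α f` exists everywhere. -/
def MultiPartialExists (α : Fin n → ℕ) (f : Eucl n → F) : Prop := IterPartialExists (word α) f

/-- `(∂_y^α ∂_η^β L)(y, η)`. -/
def mixedPartial (α β : Fin n → ℕ) (L : Eucl n → Eucl n → F) (y η : Eucl n) : F :=
  multiPartial α (fun y' => multiPartial β (L y') η) y

/-- The classical derivatives `∂_y^α ∂_η^β L` exist everywhere for all `|α|, |β| ≤ k`. -/
def MixedPartialsExist (k : ℕ) (L : Eucl n → Eucl n → F) : Prop :=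
  ∀ α β : Fin n → ℕ, order α ≤ k → order β ≤ k →
    (∀ y, MultiPartialExists β (L y)) ∧
    ∀ η, MultiPartialExists α (fun y => multiPartial β (L y) η)

/-- The seminorm `sup_{|α|, |β| ≤ k} sup_{y, η} ‖∂_y^α ∂_η^β L (y, η)‖`, with value `∞` if the
supremum is not finite. -/
def symbolSeminorm (k : ℕ) (L : Eucl n → Eucl n → F) : ℝ≥0∞ :=
  ⨆ (α : Fin n → ℕ) (β : Fin n → ℕ) (_ : order α ≤ k) (_ : order β ≤ k) (y : Eucl n) (η : Eucl n),
    ‖mixedPartial α β L y η‖ₑ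

end Derivatives

section Operators

variable {n : ℕ} {H : Type*} [NormedAddCommGroup H] [InnerProductSpace ℂ H]

/-- The Fourier transform `∫ e^{-i ξ·y} u(y) dy`. -/
def fourierHat (u : Eucl n → H) (ξ : Eucl n) : H :=
  ∫ y, Complex.exp (-(Complex.I * (inner ℝ ξ y : ℝ))) • u y

/-- The integrand `e^{i y·η} L(y, η) û(η)` of the pseudodifferential operator. -/
def opIntegrand (L : Eucl n → Eucl n → (H →L[ℂ] H)) (u : Eucl n → H) (y η : Eucl n) : H :=
  Complex.exp (Complex.I * (inner ℝ y η : ℝ)) • L y η (fourierHat u η)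

/-- `Op_L u (y) = (2π)^{-n} ∫ e^{i y·η} L(y, η) û(η) dη`. -/
def Op (L : Eucl n → Eucl n → (H →L[ℂ] H)) (u : Eucl n → H) (y : Eucl n) : H :=
  (((2 * Real.pi) ^ n)⁻¹ : ℝ) • ∫ η, opIntegrand L u y η

end Operators

end OpSymbol

end

/-! After the substitution η = 2πξ one has Op_L u(y) = ∫ L(y, 2πξ) e^{2πi y·ξ} 𝓕u(ξ) dξ. Pairing
with a Schwartz function v, the aim is to rewrite ⟨v, Op_L u⟩ as an integral over phase space ℝⁿ ×
ℝⁿ of the product of two square integrable functions of (y, ξ), and then to apply Cauchy–Schwarz.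

Let P(z) = 1 + ∑ zᵢ^{2m}, with reciprocal `wt m`, and let P(D) be `ellipOp m`, the operator with
Fourier symbol P. Inserting 1 = P · P⁻¹ before a Fourier transform gives e^{2πi y·ξ} 𝓕u(ξ) =
P(D_ξ)[e^{2πi y·ξ} W(y, ξ)], where W is `windowFourier` of u with window P⁻¹. Integration by parts
in ξ moves P(D_ξ) onto the symbol (`integral_symbol_ellipOp`). The phase is then given to v, and the
same device in y writes e^{-2πi y·ξ} v(y) as P(D_y) of `dualWindow`. A second integration by parts
moves P(D_y) onto the product of the reduced symbol with W, where Leibniz applies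
(`integral_inner_ellipOp`). No derivative ever falls on an oscillating factor in y.

By Plancherel and translation invariance, ‖W‖ in L²(ℝ²ⁿ) equals ‖window‖ ‖u‖
(`eLpNorm_windowFourier`), and likewise for `dualWindow`. A y-derivative of W only differentiates
the window, and derivatives of P⁻¹ are dominated by P⁻¹. So everything needs P⁻¹ ∈ L², that is n <
4m, and 2m derivatives of L in each variable, that is 2m ≤ ⌊n/2⌋ + 2; both can be met. Only the pure
derivatives ∂_{y_j}^a ∂_{η_i}^b enter. -/

noncomputable section

namespace OpSymbol

open scoped FourierTransform LineDeriv RealInnerProductSpace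

/-! ### The weight P⁻¹, its square integrability and its derivatives. -/

section Weight

variable {n : ℕ}

/-- The elliptic polynomial `1 + ∑ zᵢ^{2m}`. -/
def ellip (m : ℕ) (z : Eucl n) : ℝ := 1 + ∑ i, z i ^ (2 * m)

/-- The reciprocal of the elliptic polynomial `1 + ∑ zᵢ^{2m}`. -/
def wt (m : ℕ) (z : Eucl n) : ℝ := (ellip m z)⁻¹

lemma one_le_ellip (m : ℕ) (z : Eucl n) : 1 ≤ ellip m z :=
  le_add_of_nonneg_right (Finset.sum_nonneg fun _ _ => (even_two_mul m).pow_nonneg _)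

lemma ellip_pos (m : ℕ) (z : Eucl n) : 0 < ellip m z := one_pos.trans_le (one_le_ellip m z)

lemma wt_pos (m : ℕ) (z : Eucl n) : 0 < wt m z := inv_pos.2 (ellip_pos m z)

lemma wt_le_one (m : ℕ) (z : Eucl n) : wt m z ≤ 1 := inv_le_one_of_one_le₀ (one_le_ellip m z)

lemma ellip_mul_wt (m : ℕ) (z : Eucl n) : ellip m z * wt m z = 1 :=
  mul_inv_cancel₀ (ellip_pos m z).ne'

lemma hasTemperateGrowth_coord (i : Fin n) :
    Function.HasTemperateGrowth (fun z : Eucl n => z i) :=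
  (EuclideanSpace.proj i : Eucl n →L[ℝ] ℝ).hasTemperateGrowth

/-- The weight is (1 + ‖w‖²)⁻¹ composed with the polynomial map w(z) = (zᵢ^m)ᵢ. -/
lemma hasTemperateGrowth_wt (m : ℕ) : Function.HasTemperateGrowth (wt m : Eucl n → ℝ) := by
  have hw : Function.HasTemperateGrowth
      (fun z : Eucl n => ∑ i, (z i ^ m) • (EuclideanSpace.single i (1 : ℝ) : Eucl n)) := by
    refine .sum fun i _ => ?_
    exact ((hasTemperateGrowth_coord i).pow m).smul (.const _)
  have h := (Function.hasTemperateGrowth_one_add_norm_sq_rpow (Eucl n) (-1)).comp hw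
  suffices heq : (wt m : Eucl n → ℝ) = (fun x => (1 + ‖x‖ ^ 2) ^ (-1 : ℝ)) ∘
      fun z : Eucl n => ∑ i, (z i ^ m) • (EuclideanSpace.single i (1 : ℝ) : Eucl n) by
    rw [heq]
    exact h
  funext z
  simp only [Function.comp, Real.rpow_neg_one, wt, ellip]
  congr 2
  rw [EuclideanSpace.norm_sq_eq]
  refine Finset.sum_congr rfl fun i _ => ?_
  have : (∑ j, (z j ^ m) • (EuclideanSpace.single j (1 : ℝ) : Eucl n)) i = z i ^ m := by
    simp [Finset.sum_apply, Pi.single_apply]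
  rw [this, Real.norm_eq_abs, sq_abs, ← pow_mul, mul_comm m 2]

lemma pow_le_ellip_pow (m k : ℕ) {a : ℕ} (ha : a ≤ 2 * m * k) (j : Fin n) (z : Eucl n) :
    |z j| ^ a ≤ ellip m z ^ k := by
  rcases le_total |z j| 1 with h | h
  · exact (pow_le_one₀ (abs_nonneg _) h).trans (one_le_pow₀ (one_le_ellip m z))
  · calc |z j| ^ a ≤ |z j| ^ (2 * m * k) := pow_le_pow_right₀ h ha
      _ = (z j ^ (2 * m)) ^ k := by rw [pow_mul, (even_two_mul m).pow_abs]
      _ ≤ ellip m z ^ k := by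
        refine pow_le_pow_left₀ ((even_two_mul m).pow_nonneg _) ?_ k
        have := Finset.single_le_sum (f := fun i => z i ^ (2 * m))
          (fun i _ => (even_two_mul m).pow_nonneg _) (Finset.mem_univ j)
        exact this.trans (le_add_of_nonneg_left zero_le_one)

/-- With t = max(1, maxᵢ |zᵢ|) one has ‖z‖ ≤ n t, and t^{2m} is at most P(z) because it is either 1
or one of the summands. -/
lemma one_add_norm_pow_le_ellip (m : ℕ) (z : Eucl n) :
    (1 + ‖z‖) ^ (2 * m) ≤ (n + 1 : ℝ) ^ (2 * m) * ellip m z := by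
  have key : ∃ t : ℝ, 0 ≤ t ∧ (∀ i, |z i| ≤ t) ∧ 1 ≤ t ∧ t ^ (2 * m) ≤ ellip m z := by
    by_cases h : ∃ i, 1 ≤ |z i|
    · obtain ⟨i₀, hi₀⟩ := h
      obtain ⟨i, -, hi⟩ := Finset.exists_max_image Finset.univ (fun i => |z i|) ⟨i₀, Finset.mem_univ _⟩
      refine ⟨|z i|, abs_nonneg _, fun j => hi j (Finset.mem_univ _),
        hi₀.trans (hi i₀ (Finset.mem_univ _)), ?_⟩
      simpa using pow_le_ellip_pow m 1 (a := 2 * m) (by simp) i z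
    · push Not at h
      exact ⟨1, zero_le_one, fun i => (h i).le, le_rfl, by simpa using one_le_ellip m z⟩
  obtain ⟨t, ht0, ht, ht1, hte⟩ := key
  have hz : ‖z‖ ≤ n * t := by
    have : z = ∑ i, (z i) • (EuclideanSpace.single i (1 : ℝ) : Eucl n) := by
      ext j; simp [Finset.sum_apply, Pi.single_apply]
    calc ‖z‖ = ‖∑ i, (z i) • (EuclideanSpace.single i (1 : ℝ) : Eucl n)‖ := by rw [← this]
      _ ≤ ∑ i, ‖(z i) • (EuclideanSpace.single i (1 : ℝ) : Eucl n)‖ := norm_sum_le _ _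
      _ ≤ ∑ _i : Fin n, t := Finset.sum_le_sum fun i _ => by simpa [norm_smul] using ht i
      _ = n * t := by simp
  calc (1 + ‖z‖) ^ (2 * m) ≤ ((n + 1) * t) ^ (2 * m) := by
        refine pow_le_pow_left₀ (by positivity) ?_ _
        linarith
    _ = (n + 1 : ℝ) ^ (2 * m) * t ^ (2 * m) := mul_pow _ _ _
    _ ≤ _ := by gcongr

/-- The square of the weight decays like (1 + ‖z‖)^{-4m}, which is integrable exactly when 4m
exceeds the dimension. -/
lemma memLp_wt {m : ℕ} (hm : n < 4 * m) : MemLp (wt m : Eucl n → ℝ) 2 volume := by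
  have hc : Continuous (wt m : Eucl n → ℝ) := (hasTemperateGrowth_wt m).1.continuous
  rw [memLp_two_iff_integrable_sq hc.aestronglyMeasurable]
  have hI : Integrable (fun z : Eucl n => ((n + 1 : ℝ) ^ (2 * m)) ^ 2 * (1 + ‖z‖) ^ (-(4 * m : ℕ) : ℝ)) :=
    (integrable_one_add_norm (by rw [finrank_euclideanSpace_fin]; exact_mod_cast hm)).const_mul _
  refine hI.mono' (hc.pow 2).aestronglyMeasurable (.of_forall fun z => ?_)
  have h1 := one_add_norm_pow_le_ellip m z
  have h0 : 0 < (1 + ‖z‖) ^ (2 * m) := by positivity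
  rw [Real.norm_of_nonneg (sq_nonneg _), Real.rpow_neg (by positivity), Real.rpow_natCast,
    show 4 * m = 2 * m * 2 by ring, pow_mul (1 + ‖z‖), ← inv_pow, ← mul_pow]
  refine pow_le_pow_left₀ (wt_pos m z).le ?_ 2
  rw [wt, ← div_eq_mul_inv, inv_le_iff_one_le_mul₀ (ellip_pos m z), div_mul_eq_mul_div,
    one_le_div h0]
  exact h1

/-- Linear combinations of the functions `z_j^a G^{k+1}`, `a ≤ 2mk`, where `G` is the reciprocal
of `1 + ∑ zᵢ^{2m}`. This space is stable under `∂_j`. -/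
def wtSpan (m : ℕ) (j : Fin n) : Submodule ℝ (Eucl n → ℝ) :=
  Submodule.span ℝ {f | ∃ a k : ℕ, a ≤ 2 * m * k ∧ f = fun z => z j ^ a * wt m z ^ (k + 1)}

lemma wt_mem_wtSpan (m : ℕ) (j : Fin n) : wt m ∈ wtSpan m j :=
  Submodule.subset_span ⟨0, 0, by simp, by simp⟩

lemma hasTemperateGrowth_of_mem_wtSpan {m : ℕ} {j : Fin n} {f : Eucl n → ℝ}
    (hf : f ∈ wtSpan m j) : Function.HasTemperateGrowth f := by
  induction hf using Submodule.span_induction with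
  | mem f hf =>
    obtain ⟨a, k, -, rfl⟩ := hf
    exact ((hasTemperateGrowth_coord j).pow a).mul ((hasTemperateGrowth_wt m).pow (k + 1))
  | zero => exact .zero
  | add f g _ _ hf hg => exact hf.add hg
  | smul c f _ hf => exact (Function.HasTemperateGrowth.const c).smul hf

/-- Each z_j^a G^k with a ≤ 2mk is bounded, and one factor G is left over. Hence all derivatives of
the weight inherit its L² property. -/
lemma exists_abs_le_of_mem_wtSpan {m : ℕ} {j : Fin n} {f : Eucl n → ℝ}
    (hf : f ∈ wtSpan m j) : ∃ C : ℝ, 0 ≤ C ∧ ∀ z, |f z| ≤ C * wt m z := by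
  induction hf using Submodule.span_induction with
  | mem f hf =>
    obtain ⟨a, k, ha, rfl⟩ := hf
    refine ⟨1, zero_le_one, fun z => ?_⟩
    have h := pow_le_ellip_pow m k ha j z
    have hw := wt_pos m z
    rw [abs_mul, abs_pow, abs_of_pos (pow_pos hw _), pow_succ, ← mul_assoc]
    gcongr
    calc |z j| ^ a * wt m z ^ k ≤ ellip m z ^ k * wt m z ^ k := by gcongr
      _ = 1 := by rw [← mul_pow, ellip_mul_wt, one_pow]
  | zero => exact ⟨0, le_rfl, fun z => by simp⟩
  | add f g _ _ hf hg =>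
    obtain ⟨C, hC, hf⟩ := hf
    obtain ⟨D, hD, hg⟩ := hg
    refine ⟨C + D, add_nonneg hC hD, fun z => ?_⟩
    calc |f z + g z| ≤ |f z| + |g z| := abs_add_le _ _
      _ ≤ (C + D) * wt m z := by rw [add_mul]; exact add_le_add (hf z) (hg z)
  | smul c f _ hf =>
    obtain ⟨C, hC, hf⟩ := hf
    refine ⟨|c| * C, by positivity, fun z => ?_⟩
    rw [Pi.smul_apply, smul_eq_mul, abs_mul, mul_assoc]
    exact mul_le_mul_of_nonneg_left (hf z) (abs_nonneg c)

lemma hasDerivAt_coord_line (j : Fin n) (z : Eucl n) :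
    HasDerivAt (fun t : ℝ => (z + t • (EuclideanSpace.single j (1 : ℝ) : Eucl n)) j) 1 0 := by
  have : (fun t : ℝ => (z + t • (EuclideanSpace.single j (1 : ℝ) : Eucl n)) j) =
      fun t => z j + t := by
    funext t; simp
  rw [this]
  exact (hasDerivAt_id' (0 : ℝ)).const_add _

lemma hasLineDerivAt_wt (m : ℕ) (j : Fin n) (z : Eucl n) :
    HasLineDerivAt ℝ (wt m) (-((2 * m : ℕ) * z j ^ (2 * m - 1) * wt m z ^ 2)) z
      (EuclideanSpace.single j 1) := by
  unfold HasLineDerivAt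
  have h1 : HasDerivAt (fun t : ℝ => ellip m (z + t • (EuclideanSpace.single j (1 : ℝ) : Eucl n)))
      ((2 * m : ℕ) * z j ^ (2 * m - 1)) 0 := by
    have : ∀ i ∈ Finset.univ, HasDerivAt
        (fun t : ℝ => (z + t • (EuclideanSpace.single j (1 : ℝ) : Eucl n)) i ^ (2 * m))
        (if i = j then (2 * m : ℕ) * z j ^ (2 * m - 1) else 0) 0 := by
      intro i _
      split_ifs with h
      · subst h
        simpa using (hasDerivAt_coord_line i z).fun_pow (2 * m)
      · have : (fun t : ℝ => (z + t • (EuclideanSpace.single j (1 : ℝ) : Eucl n)) i ^ (2 * m)) =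
            fun _ => z i ^ (2 * m) := by
          funext t; simp [h]
        rw [this]
        exact hasDerivAt_const _ _
    have h2 := (HasDerivAt.fun_sum this).const_add (1 : ℝ)
    simpa [ellip] using h2
  have h3 := h1.fun_inv (by simpa using (ellip_pos m z).ne')
  refine h3.congr_deriv ?_
  simp only [zero_smul, add_zero, wt, inv_pow]
  rw [neg_div, div_eq_mul_inv]

lemma exists_hasLineDerivAt_of_mem_wtSpan {m : ℕ} {j : Fin n} {f : Eucl n → ℝ}
    (hf : f ∈ wtSpan m j) :
    ∃ f' ∈ wtSpan m j, ∀ z, HasLineDerivAt ℝ f (f' z) z (EuclideanSpace.single j 1) := by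
  induction hf using Submodule.span_induction with
  | mem f hf =>
    obtain ⟨a, k, ha, rfl⟩ := hf
    -- Product rule, with ∂_j G = -2m z_j^{2m-1} G². For `a = 0` the truncated exponent `a - 1` is
    -- harmless, since its coefficient vanishes.
    refine ⟨(a : ℝ) • (fun z => z j ^ (a - 1) * wt m z ^ (k + 1)) +
        (-((k + 1 : ℕ) * (2 * m : ℕ) : ℝ)) •
          (fun z => z j ^ (a + (2 * m - 1)) * wt m z ^ (k + 1 + 1)), ?_, fun z => ?_⟩
    · rcases Nat.eq_zero_or_pos m with rfl | hm
      · simp only [Nat.cast_zero, mul_zero, neg_zero, zero_smul, add_zero]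
        exact Submodule.smul_mem _ _ (Submodule.subset_span ⟨a - 1, k, by omega, rfl⟩)
      · refine Submodule.add_mem _ (Submodule.smul_mem _ _ (Submodule.subset_span
          ⟨a - 1, k, by omega, rfl⟩)) (Submodule.smul_mem _ _ (Submodule.subset_span
          ⟨a + (2 * m - 1), k + 1, ?_, rfl⟩))
        rw [mul_add, mul_one]; omega
    · have h1 := (hasDerivAt_coord_line j z).fun_pow a
      have h2 : HasDerivAt (fun t : ℝ => wt m (z + t • (EuclideanSpace.single j (1 : ℝ) : Eucl n)) ^ (k + 1)) _ 0 :=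
        HasDerivAt.fun_pow (hasLineDerivAt_wt m j z) (k + 1)
      refine (h1.mul h2).congr_deriv ?_
      simp only [zero_smul, add_zero, Pi.add_apply, Pi.smul_apply, smul_eq_mul, pow_add, pow_one,
        Nat.add_sub_cancel]
      ring
  | zero => exact ⟨0, Submodule.zero_mem _, fun z => hasDerivAt_const _ _⟩
  | add f g _ _ hf hg =>
    obtain ⟨f', hf', hf⟩ := hf
    obtain ⟨g', hg', hg⟩ := hg
    exact ⟨f' + g', Submodule.add_mem _ hf' hg', fun z => HasDerivAt.add (hf z) (hg z)⟩
  | smul c f _ hf =>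
    obtain ⟨f', hf', hf⟩ := hf
    exact ⟨c • f', Submodule.smul_mem _ _ hf', fun z => HasDerivAt.const_smul c (hf z)⟩

end Weight

/-! ### The elliptic operator on the Fourier side, and the windowed Fourier transform. -/

section Schwartz

variable {n : ℕ} {H : Type*} [NormedAddCommGroup H] [InnerProductSpace ℂ H]

/-- Multiplication of a Schwartz function by the coordinate `z_i`. -/
def coordMul (i : Fin n) : 𝓢(Eucl n, H) →L[ℝ] 𝓢(Eucl n, H) :=
  SchwartzMap.smulLeftCLM H (fun z : Eucl n => inner ℝ z (EuclideanSpace.single i (1 : ℝ)))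

lemma coordMul_iterate_apply (i : Fin n) (k : ℕ) (f : 𝓢(Eucl n, H)) (z : Eucl n) :
    ((coordMul i)^[k] f) z = (z i ^ k) • f z := by
  induction k with
  | zero => simp
  | succ k ih =>
    have hg : (fun z : Eucl n => (inner ℝ z (EuclideanSpace.single i (1 : ℝ)) : ℝ)).HasTemperateGrowth := by
      fun_prop
    rw [Function.iterate_succ_apply', coordMul, SchwartzMap.smulLeftCLM_apply_apply hg,
      ← coordMul, ih, smul_smul, pow_succ']
    simp [EuclideanSpace.inner_single_right]

lemma coordMul_eq (i : Fin n) (f : 𝓢(Eucl n, H)) :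
    SchwartzMap.smulLeftCLM H (fun z : Eucl n => inner ℝ z (EuclideanSpace.single i (1 : ℝ))) f =
      coordMul i f := rfl

/-- The constant for which `1 + c ∑ ∂ᵢ^{2m}` has Fourier symbol `1 + ∑ ξᵢ^{2m}`. -/
def ellipConst (m : ℕ) : ℝ := (-1) ^ m * ((2 * Real.pi) ^ (2 * m))⁻¹

/-- The differential operator `1 + c ∑ ∂ᵢ^{2m}` whose Fourier symbol is `1 + ∑ ξᵢ^{2m}`. -/
def ellipOp (m : ℕ) (f : 𝓢(Eucl n, H)) : 𝓢(Eucl n, H) :=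
  f + ∑ i, ellipConst m • (∂_{(EuclideanSpace.single i (1 : ℝ) : Eucl n)})^[2 * m] f

/-- Since s² = -(2π)² for both signs, the even order 2m makes a single constant serve both 𝓕 and 𝓕⁻.
-/
lemma ellipConst_smul (m : ℕ) {s : ℂ} (hs : s = 2 * Real.pi * Complex.I ∨ s = -(2 * Real.pi * Complex.I))
    {V : Type*} [AddCommGroup V] [Module ℂ V] (x : V) :
    ellipConst m • (s ^ (2 * m) • x) = x := by
  have h2 : s ^ (2 * m) = (((-1) ^ m * (2 * Real.pi) ^ (2 * m) : ℝ) : ℂ) := by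
    have : s ^ 2 = -(2 * Real.pi : ℂ) ^ 2 := by
      rcases hs with rfl | rfl <;> ring_nf <;> simp
    rw [pow_mul, this, neg_pow, pow_mul]
    push_cast
    ring
  rw [← Complex.coe_smul (ellipConst m), smul_smul, h2, ← Complex.ofReal_mul, ellipConst]
  have hpi : (2 * Real.pi) ^ (2 * m) ≠ 0 := by positivity
  have h1 : ((-1 : ℝ) ^ m) * (-1) ^ m = 1 := by rw [← mul_pow]; simp
  have : (-1 : ℝ) ^ m * ((2 * Real.pi) ^ (2 * m))⁻¹ * ((-1) ^ m * (2 * Real.pi) ^ (2 * m)) = 1 := by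
    field_simp
    linarith
  rw [this]
  simp

lemma ellip_smul_wt_smul (m : ℕ) (w : 𝓢(Eucl n, H)) :
    SchwartzMap.smulLeftCLM H (wt m) w +
      ∑ i, (coordMul i)^[2 * m] (SchwartzMap.smulLeftCLM H (wt m) w) = w := by
  ext z
  rw [add_apply, sum_apply]
  simp_rw [coordMul_iterate_apply]
  rw [← Finset.sum_smul, SchwartzMap.smulLeftCLM_apply_apply (hasTemperateGrowth_wt m)]
  nth_rewrite 1 [← one_smul ℝ (wt m z • w z)]
  rw [← add_smul, smul_smul]
  change (ellip m z * wt m z) • w z = w z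
  rw [ellip_mul_wt, one_smul]

lemma lineDerivOp_iterate_fourier (i : Fin n) (k : ℕ) (f : 𝓢(Eucl n, H)) :
    (∂_{(EuclideanSpace.single i (1 : ℝ) : Eucl n)})^[k] (𝓕 f) =
      (-(2 * Real.pi * Complex.I)) ^ k • 𝓕 ((coordMul i)^[k] f) := by
  induction k with
  | zero => simp
  | succ k ih =>
    rw [Function.iterate_succ_apply', ih, LineDeriv.lineDerivOp_smul,
      SchwartzMap.lineDerivOp_fourier_eq, coordMul_eq, FourierTransform.fourier_smul, smul_smul,
      ← pow_succ, ← Function.iterate_succ_apply' (coordMul i)]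

lemma lineDerivOp_iterate_fourierInv (i : Fin n) (k : ℕ) (f : 𝓢(Eucl n, H)) :
    (∂_{(EuclideanSpace.single i (1 : ℝ) : Eucl n)})^[k] (𝓕⁻ f) =
      (2 * Real.pi * Complex.I) ^ k • 𝓕⁻ ((coordMul i)^[k] f) := by
  induction k with
  | zero => simp
  | succ k ih =>
    rw [Function.iterate_succ_apply', ih, LineDeriv.lineDerivOp_smul,
      SchwartzMap.lineDerivOp_fourierInv_eq, coordMul_eq, FourierTransform.fourierInv_smul, smul_smul,
      ← pow_succ, ← Function.iterate_succ_apply' (coordMul i)]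

/-- Derivatives of 𝓕 are 𝓕 of coordinate multiplications, so the operator multiplies by P under 𝓕
and cancels the weight. -/
lemma ellipOp_fourier (m : ℕ) (w : 𝓢(Eucl n, H)) :
    ellipOp m (𝓕 (SchwartzMap.smulLeftCLM H (wt m) w)) = 𝓕 w := by
  simp_rw [ellipOp, lineDerivOp_iterate_fourier, ellipConst_smul m (Or.inr rfl)]
  nth_rewrite 3 [← ellip_smul_wt_smul m w]
  rw [FourierTransform.fourier_add]
  congr 1
  exact (map_sum (FourierTransform.fourierCLM ℂ 𝓢(Eucl n, H)) _ _).symm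

lemma ellipOp_fourierInv [CompleteSpace H] (m : ℕ) (w : 𝓢(Eucl n, H)) :
    ellipOp m (𝓕⁻ (SchwartzMap.smulLeftCLM H (wt m) w)) = 𝓕⁻ w := by
  simp_rw [ellipOp, lineDerivOp_iterate_fourierInv, ellipConst_smul m (Or.inl rfl)]
  nth_rewrite 3 [← ellip_smul_wt_smul m w]
  rw [FourierTransform.fourierInv_add]
  congr 1
  exact (map_sum (FourierTransform.fourierInvCLM ℂ 𝓢(Eucl n, H)) _ _).symm

/-- The Schwartz function `z ↦ q(z) w(z + y)`. -/
def mulTrans (q : Eucl n → ℝ) (w : 𝓢(Eucl n, H)) (y : Eucl n) : 𝓢(Eucl n, H) :=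
  SchwartzMap.smulLeftCLM H q (SchwartzMap.compSubConstCLM ℝ (-y) w)

lemma mulTrans_apply {q : Eucl n → ℝ} (hq : q.HasTemperateGrowth) (w : 𝓢(Eucl n, H))
    (y z : Eucl n) : mulTrans q w y z = q z • w (z + y) := by
  rw [mulTrans, SchwartzMap.smulLeftCLM_apply_apply hq, SchwartzMap.compSubConstCLM_apply,
    sub_neg_eq_add]

/-- The windowed Fourier transform `∫ e^{-2πi z·ξ} q(z - y) w(z) dz`. -/
def windowFourier (q : Eucl n → ℝ) (w : Eucl n → H) (y ξ : Eucl n) : H :=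
  ∫ z, 𝐞 (-⟪z, ξ⟫) • (q (z - y) • w z)

lemma fourier_mulTrans {q : Eucl n → ℝ} (hq : q.HasTemperateGrowth) (w : 𝓢(Eucl n, H))
    (y ξ : Eucl n) : 𝓕 (mulTrans q w y) ξ = 𝐞 ⟪y, ξ⟫ • windowFourier q w y ξ := by
  rw [SchwartzMap.fourier_coe, Real.fourier_eq, windowFourier,
    ← integral_add_right_eq_self (fun z => 𝐞 (-⟪z, ξ⟫) • (q (z - y) • w z)) y]
  rw [Circle.smul_def, ← integral_smul]
  refine integral_congr_ae (.of_forall fun z => ?_)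
  simp only [← Circle.smul_def, mulTrans_apply hq, add_sub_cancel_right, smul_smul, ← AddChar.map_add_eq_mul]
  congr 2
  rw [inner_add_left]; abel_nf

lemma fourier_translate (w : 𝓢(Eucl n, H)) (y ξ : Eucl n) :
    𝓕 (SchwartzMap.compSubConstCLM ℝ (-y) w) ξ = 𝐞 ⟪y, ξ⟫ • 𝓕 w ξ := by
  rw [SchwartzMap.fourier_coe, SchwartzMap.fourier_coe, Real.fourier_eq, Real.fourier_eq,
    ← integral_add_right_eq_self (fun z => 𝐞 (-⟪z, ξ⟫) • w z) y, Circle.smul_def, ← integral_smul]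
  refine integral_congr_ae (.of_forall fun z => ?_)
  simp only [← Circle.smul_def, SchwartzMap.compSubConstCLM_apply, sub_neg_eq_add, smul_smul, ← AddChar.map_add_eq_mul]
  congr 2
  rw [inner_add_left]; abel_nf

lemma fourierInv_translate [CompleteSpace H] (w : 𝓢(Eucl n, H)) (y ξ : Eucl n) :
    𝓕⁻ (SchwartzMap.compSubConstCLM ℝ (-ξ) (𝓕 w)) y = 𝐞 (-⟪y, ξ⟫) • w y := by
  have h0 : 𝓕⁻ (SchwartzMap.compSubConstCLM ℝ (-ξ) (𝓕 w)) y =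
      𝐞 (-⟪y, ξ⟫) • (𝓕⁻ (𝓕 w) : 𝓢(Eucl n, H)) y := by
    rw [SchwartzMap.fourierInv_coe, SchwartzMap.fourierInv_coe, Real.fourierInv_eq,
      Real.fourierInv_eq,
      ← integral_add_right_eq_self (fun z => 𝐞 ⟪z, y⟫ • (𝓕 w : 𝓢(Eucl n, H)) z) ξ,
      Circle.smul_def, ← integral_smul]
    refine integral_congr_ae (.of_forall fun z => ?_)
    simp only [← Circle.smul_def, SchwartzMap.compSubConstCLM_apply, sub_neg_eq_add, smul_smul,
      ← AddChar.map_add_eq_mul]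
    congr 2
    rw [inner_add_left, real_inner_comm y ξ]; abel_nf
  rw [h0, FourierTransform.fourierInv_fourier_eq]

lemma continuous_windowFourier {q : Eucl n → ℝ} (hq : Continuous q) {C : ℝ}
    (hC : ∀ z, |q z| ≤ C) (w : 𝓢(Eucl n, H)) :
    Continuous (fun p : Eucl n × Eucl n => windowFourier q w p.1 p.2) := by
  refine continuous_of_dominated (bound := fun z => C * ‖w z‖) (fun p => ?_) (fun p => ?_)
    (w.integrable.norm.const_mul C) (.of_forall fun z => ?_)
  · refine Continuous.aestronglyMeasurable ?_
    have := w.continuous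
    fun_prop
  · refine .of_forall fun z => ?_
    rw [Circle.norm_smul, norm_smul]
    exact mul_le_mul_of_nonneg_right (hC _) (norm_nonneg _)
  · fun_prop

lemma hasDerivAt_line {F : Type*} [NormedAddCommGroup F] [NormedSpace ℝ F] {f f' : Eucl n → F}
    {v : Eucl n} (h : ∀ z, HasLineDerivAt ℝ f (f' z) z v) (x : Eucl n) (t : ℝ) :
    HasDerivAt (fun s : ℝ => f (x + s • v)) (f' (x + t • v)) t := by
  have h1 : HasDerivAt (fun s : ℝ => f (x + t • v + s • v)) (f' (x + t • v)) (t - t) := by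
    rw [sub_self]; exact h _
  have h2 := h1.comp_sub_const t t
  refine h2.congr_of_eventuallyEq (.of_forall fun s => ?_)
  simp only
  congr 1
  rw [sub_smul]; abel

/-- The variable y occurs only in q(z - y), so differentiation under the integral hits the window
alone and produces the minus sign. -/
lemma hasLineDerivAt_windowFourier {q q' : Eucl n → ℝ} {v : Eucl n} (hq : Continuous q)
    (hq' : Continuous q') {C : ℝ} (hC : ∀ z, |q z| ≤ C) (hC' : ∀ z, |q' z| ≤ C)
    (h : ∀ z, HasLineDerivAt ℝ q (q' z) z v) (w : 𝓢(Eucl n, H)) (y ξ : Eucl n) :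
    HasLineDerivAt ℝ (fun y => windowFourier q w y ξ)
      (windowFourier (fun z => -q' z) w y ξ) y v := by
  have hw := w.continuous
  have hneg : ∀ (z : Eucl n) (t : ℝ), HasDerivAt (fun s : ℝ => q (z - (y + s • v)))
      (-q' (z - (y + t • v))) t := by
    intro z t
    have h1 := (hasDerivAt_line h (z - y) (-t)).scomp t (hasDerivAt_neg t)
    simp only [neg_smul, one_smul, Function.comp_def] at h1
    have e : ∀ s : ℝ, z - (y + s • v) = z - y + -(s • v) := fun s => by abel
    simpa only [e] using h1
  have key := hasDerivAt_integral_of_dominated_loc_of_deriv_le (μ := (volume : Measure (Eucl n)))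
    (F := fun (t : ℝ) z => 𝐞 (-⟪z, ξ⟫) • (q (z - (y + t • v)) • w z))
    (F' := fun (t : ℝ) z => 𝐞 (-⟪z, ξ⟫) • ((-q' (z - (y + t • v))) • w z)) (x₀ := 0)
    (s := Set.univ) (bound := fun z => C * ‖w z‖) Filter.univ_mem
    (.of_forall fun t => Continuous.aestronglyMeasurable (by fun_prop)) ?_
    (Continuous.aestronglyMeasurable (by fun_prop)) ?_ (w.integrable.norm.const_mul C) ?_
  · have := key.2
    simp only [zero_smul, add_zero] at this
    exact this
  · refine (w.integrable.norm.const_mul C).mono' (Continuous.aestronglyMeasurable (by fun_prop))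
      (.of_forall fun z => ?_)
    rw [Circle.norm_smul, norm_smul]
    exact mul_le_mul_of_nonneg_right (hC _) (norm_nonneg _)
  · refine .of_forall fun z t _ => ?_
    rw [Circle.norm_smul, norm_smul, norm_neg]
    exact mul_le_mul_of_nonneg_right (hC' _) (norm_nonneg _)
  · refine .of_forall fun z t _ => ?_
    simp only [Circle.smul_def]
    exact ((hneg z t).smul_const (w z)).const_smul _

lemma eLpNorm_two_sq {α F : Type*} [MeasurableSpace α] [NormedAddCommGroup F] (f : α → F)
    (μ : Measure α) : eLpNorm f 2 μ ^ 2 = ∫⁻ x, ‖f x‖ₑ ^ 2 ∂μ := by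
  have := eLpNorm_nnreal_pow_eq_lintegral (f := f) (μ := μ) (p := 2) two_ne_zero
  simpa using this

lemma eLpNorm_fourier [CompleteSpace H] (f : 𝓢(Eucl n, H)) :
    eLpNorm (𝓕 f : 𝓢(Eucl n, H)) 2 volume = eLpNorm f 2 volume := by
  have h := SchwartzMap.norm_fourier_toL2_eq f
  rw [SchwartzMap.norm_toLp, SchwartzMap.norm_toLp] at h
  have h1 := (SchwartzMap.eLpNorm_lt_top (𝓕 f : 𝓢(Eucl n, H)) 2 volume).ne
  have h2 := (SchwartzMap.eLpNorm_lt_top f 2 volume).ne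
  rw [← ENNReal.ofReal_toReal h1, h, ENNReal.ofReal_toReal h2]

/-- For fixed y, Plancherel in ξ gives ∫ |q(z - y)|² ‖w(z)‖² dz; Tonelli and translation invariance
in y then separate the two factors. -/
lemma eLpNorm_windowFourier [CompleteSpace H] {q : Eucl n → ℝ} (hq : q.HasTemperateGrowth) {C : ℝ}
    (hC : ∀ z, |q z| ≤ C) (w : 𝓢(Eucl n, H)) :
    eLpNorm (fun p : Eucl n × Eucl n => windowFourier q w p.1 p.2) 2 (volume.prod volume) =
      eLpNorm q 2 volume * eLpNorm w 2 volume := by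
  have hqc : Continuous q := hq.1.continuous
  have hwc := w.continuous
  rw [← ENNReal.pow_right_strictMono two_ne_zero |>.injective.eq_iff]
  rw [mul_pow, eLpNorm_two_sq, eLpNorm_two_sq, eLpNorm_two_sq, lintegral_prod _
    ((continuous_windowFourier hqc hC w).enorm.measurable.pow_const 2).aemeasurable]
  have h1 : ∀ y : Eucl n, ∫⁻ ξ, ‖windowFourier q w y ξ‖ₑ ^ 2 =
      ∫⁻ z, ‖q (z - y)‖ₑ ^ 2 * ‖w z‖ₑ ^ 2 := by
    intro y
    calc ∫⁻ ξ, ‖windowFourier q w y ξ‖ₑ ^ 2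
        = ∫⁻ ξ, ‖(𝓕 (mulTrans q w y) : 𝓢(Eucl n, H)) ξ‖ₑ ^ 2 := by
          refine lintegral_congr fun ξ => ?_
          rw [fourier_mulTrans hq, ← ofReal_norm, ← ofReal_norm, Circle.norm_smul]
      _ = ∫⁻ z, ‖mulTrans q w y z‖ₑ ^ 2 := by
          rw [← eLpNorm_two_sq, eLpNorm_fourier, eLpNorm_two_sq]
      _ = ∫⁻ z, ‖q z‖ₑ ^ 2 * ‖w (z + y)‖ₑ ^ 2 := by
          refine lintegral_congr fun z => ?_
          rw [mulTrans_apply hq, enorm_smul, mul_pow]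
      _ = _ := by
          rw [← lintegral_add_right_eq_self (fun z => ‖q (z - y)‖ₑ ^ 2 * ‖w z‖ₑ ^ 2) y]
          simp
  simp_rw [h1]
  have hm : Measurable (fun p : Eucl n × Eucl n => ‖q (p.2 - p.1)‖ₑ ^ 2 * ‖w p.2‖ₑ ^ 2) := by
    have h1 : Continuous (fun p : Eucl n × Eucl n => q (p.2 - p.1)) := by fun_prop
    have h2 : Continuous (fun p : Eucl n × Eucl n => w p.2) := by fun_prop
    exact (h1.enorm.measurable.pow_const 2).mul (h2.enorm.measurable.pow_const 2)
  rw [lintegral_lintegral_swap hm.aemeasurable]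
  have h2 : ∀ z : Eucl n, ∫⁻ y, ‖q (z - y)‖ₑ ^ 2 * ‖w z‖ₑ ^ 2 =
      (∫⁻ y, ‖q y‖ₑ ^ 2) * ‖w z‖ₑ ^ 2 := by
    intro z
    rw [lintegral_mul_const' _ _ (by simp), lintegral_sub_left_eq_self (fun y => ‖q y‖ₑ ^ 2) z]
  simp_rw [h2]
  rw [lintegral_const_mul _ (hwc.enorm.measurable.pow_const 2)]

lemma seminorm_translate_le (k l : ℕ) (w : 𝓢(Eucl n, H)) (y : Eucl n) :
    SchwartzMap.seminorm ℝ k l (SchwartzMap.compSubConstCLM ℝ (-y) w) ≤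
      (2 ^ k * (Finset.Iic (k, l)).sup (fun m => SchwartzMap.seminorm ℝ m.1 m.2) w) *
        (1 + ‖y‖) ^ k := by
  refine SchwartzMap.seminorm_le_bound ℝ k l _ (by positivity) fun x => ?_
  have h1 : iteratedFDeriv ℝ l (SchwartzMap.compSubConstCLM ℝ (-y) w) x =
      iteratedFDeriv ℝ l w (x - -y) :=
    iteratedFDeriv_comp_sub (𝕜 := ℝ) (f := (w : Eucl n → H)) l (-y) x
  have h2 : ‖x‖ ≤ (1 + ‖y‖) * (1 + ‖x - -y‖) := by
    have : ‖x‖ ≤ ‖x - -y‖ + ‖y‖ := by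
      calc ‖x‖ = ‖x - -y + -y‖ := by abel_nf
        _ ≤ _ := (norm_add_le _ _).trans (by rw [norm_neg])
    nlinarith [norm_nonneg y, norm_nonneg (x - -y)]
  rw [h1]
  calc ‖x‖ ^ k * ‖iteratedFDeriv ℝ l w (x - -y)‖
      ≤ ((1 + ‖y‖) * (1 + ‖x - -y‖)) ^ k * ‖iteratedFDeriv ℝ l w (x - -y)‖ := by gcongr
    _ = (1 + ‖x - -y‖) ^ k * ‖iteratedFDeriv ℝ l w (x - -y)‖ * (1 + ‖y‖) ^ k := by
      rw [mul_pow]; ring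
    _ ≤ _ := by
      refine mul_le_mul_of_nonneg_right ?_ (by positivity)
      exact SchwartzMap.one_add_le_sup_seminorm_apply (𝕜 := ℝ) (m := (k, l)) le_rfl le_rfl w (x - -y)

/-- Rapid decay in ξ with at most polynomial loss in y, needed to justify Fubini. Multiplication by
q followed by 𝓕 is continuous, so finitely many Schwartz seminorms of the translate control the left
side, and these grow polynomially in y. -/
lemma exists_norm_fourier_mulTrans_le (q : Eucl n → ℝ) (w : 𝓢(Eucl n, H)) (r : ℕ) :
    ∃ (C : ℝ) (k : ℕ), 0 ≤ C ∧ ∀ y ξ,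
      (1 + ‖ξ‖) ^ r * ‖𝓕 (mulTrans q w y) ξ‖ ≤ C * (1 + ‖y‖) ^ k := by
  let A : 𝓢(Eucl n, H) →L[ℝ] 𝓢(Eucl n, H) :=
    (FourierTransform.fourierCLM ℝ 𝓢(Eucl n, H)).comp (SchwartzMap.smulLeftCLM H q)
  let P : Seminorm ℝ 𝓢(Eucl n, H) :=
    ((Finset.Iic (r, 0)).sup (fun m => SchwartzMap.seminorm ℝ m.1 m.2)).comp A.toLinearMap
  have hP : Continuous P := by
    have h1 : Continuous
        ((Finset.Iic (r, 0)).sup (schwartzSeminormFamily ℝ (Eucl n) H) : Seminorm ℝ 𝓢(Eucl n, H)) := by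
      refine Seminorm.continuous_finsetSup fun i _ => ?_
      exact (schwartz_withSeminorms ℝ (Eucl n) H).continuous_seminorm i
    exact h1.comp A.continuous
  obtain ⟨s, C, -, hs⟩ := Seminorm.bound_of_continuous (schwartz_withSeminorms ℝ (Eucl n) H) P hP
  let K : ℝ := ∑ m ∈ s, 2 ^ m.1 * (Finset.Iic m).sup (fun m => SchwartzMap.seminorm ℝ m.1 m.2) w
  have hK : 0 ≤ K := Finset.sum_nonneg fun m _ => by positivity
  refine ⟨2 ^ r * (C * K), s.sup Prod.fst, by positivity, fun y ξ => ?_⟩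
  have h1 := SchwartzMap.one_add_le_sup_seminorm_apply (𝕜 := ℝ) (m := (r, 0)) le_rfl le_rfl
    (𝓕 (mulTrans q w y)) ξ
  rw [norm_iteratedFDeriv_zero] at h1
  have h2 : (s.sup (schwartzSeminormFamily ℝ (Eucl n) H) : Seminorm ℝ 𝓢(Eucl n, H))
      (SchwartzMap.compSubConstCLM ℝ (-y) w) ≤
      K * (1 + ‖y‖) ^ (s.sup Prod.fst) := by
    refine Seminorm.finset_sup_apply_le (by positivity) fun m hm => ?_
    refine (seminorm_translate_le m.1 m.2 w y).trans ?_
    refine mul_le_mul ?_ ?_ (by positivity) hK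
    · exact Finset.single_le_sum
        (f := fun m : ℕ × ℕ => 2 ^ m.1 * (Finset.Iic m).sup (fun m => SchwartzMap.seminorm ℝ m.1 m.2) w)
        (fun m _ => by positivity) hm
    · exact pow_le_pow_right₀ (by linarith [norm_nonneg y]) (Finset.le_sup (f := Prod.fst) hm)
  have h3 := hs (SchwartzMap.compSubConstCLM ℝ (-y) w)
  calc (1 + ‖ξ‖) ^ r * ‖𝓕 (mulTrans q w y) ξ‖
      ≤ 2 ^ r * P (SchwartzMap.compSubConstCLM ℝ (-y) w) := h1
    _ ≤ 2 ^ r * (C * (K * (1 + ‖y‖) ^ (s.sup Prod.fst))) := by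
      refine mul_le_mul_of_nonneg_left (h3.trans ?_) (by positivity)
      exact mul_le_mul_of_nonneg_left h2 C.2
    _ = _ := by ring

end Schwartz

/-! ### Calculus with directional derivatives: mean value, measurability, integration by parts,
Leibniz. -/

section Calculus

variable {n : ℕ} {F : Type*} [NormedAddCommGroup F] [NormedSpace ℝ F]

lemma norm_sub_le_of_lineDeriv_le {f : Eucl n → F} {f' : Fin n → Eucl n → F} {B : ℝ}
    (h : ∀ i z, HasLineDerivAt ℝ f (f' i z) z (EuclideanSpace.single i 1))
    (hB : ∀ i z, ‖f' i z‖ ≤ B) (x y : Eucl n) :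
    ‖f x - f y‖ ≤ B * ∑ i, |x i - y i| := by
  classical
  -- The point with coordinates of x on s and of y elsewhere; enlarging s by one index moves along a
  -- coordinate line, where the mean value inequality applies.
  let p : Finset (Fin n) → Eucl n := fun s => WithLp.toLp 2 fun i => if i ∈ s then x i else y i
  have key : ∀ s : Finset (Fin n), ‖f (p s) - f y‖ ≤ B * ∑ i ∈ s, |x i - y i| := by
    intro s
    induction s using Finset.induction_on with
    | empty =>
      have : p ∅ = y := by ext i; simp [p]
      simp [this]
    | insert i s hi ih =>
      have hp : p (insert i s) = p s + (x i - y i) • EuclideanSpace.single i (1 : ℝ) := by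
        ext j
        by_cases hj : j = i
        · subst hj; simp [p, hi]
        · simp [p, hj]
      have h1 := convex_univ.norm_image_sub_le_of_norm_hasDerivWithin_le
        (f := fun t : ℝ => f (p s + t • EuclideanSpace.single i (1 : ℝ))) (C := B)
        (fun t _ => (hasDerivAt_line (h i) (p s) t).hasDerivWithinAt) (fun t _ => hB i _)
        (Set.mem_univ 0) (Set.mem_univ (x i - y i))
      simp only [zero_smul, add_zero, sub_zero, ← hp, Real.norm_eq_abs] at h1
      rw [Finset.sum_insert hi, mul_add]
      calc ‖f (p (insert i s)) - f y‖ ≤ ‖f (p (insert i s)) - f (p s)‖ + ‖f (p s) - f y‖ :=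
            norm_sub_le_norm_sub_add_norm_sub _ _ _
        _ ≤ _ := add_le_add h1 ih
  have hx : p Finset.univ = x := by ext i; simp [p]
  simpa [hx] using key Finset.univ

/-- The derivative is a pointwise limit of difference quotients with steps 1/(k+1). Measurability of
the top-order derivatives of the symbol comes from here, as they are not assumed continuous. -/
lemma stronglyMeasurable_lineDeriv_snd {X : Type*} [MeasurableSpace X] {f : X → Eucl n → F}
    {v : Eucl n} (hf : StronglyMeasurable fun p : X × Eucl n => f p.1 p.2)
    (hd : ∀ x z, LineDifferentiableAt ℝ (f x) z v) :
    StronglyMeasurable fun p : X × Eucl n => lineDeriv ℝ (f p.1) p.2 v := by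
  let t : ℕ → ℝ := fun k => 1 / ((k : ℝ) + 1)
  have ht : Filter.Tendsto t Filter.atTop (nhdsWithin 0 {0}ᶜ) := by
    refine tendsto_nhdsWithin_iff.2 ⟨tendsto_one_div_add_atTop_nhds_zero_nat, .of_forall fun k => ?_⟩
    have : (0 : ℝ) < 1 / ((k : ℝ) + 1) := by positivity
    exact this.ne'
  refine stronglyMeasurable_of_tendsto Filter.atTop
    (f := fun (k : ℕ) (p : X × Eucl n) => (t k)⁻¹ • (f p.1 (p.2 + t k • v) - f p.1 p.2))
    (fun k => ?_) ?_
  · have hg : Measurable fun p : X × Eucl n => (p.1, p.2 + t k • v) := by fun_prop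
    exact ((hf.comp_measurable hg).sub hf).const_smul _
  · rw [tendsto_pi_nhds]
    intro p
    have h1 := (hd p.1 p.2).hasLineDerivAt.tendsto_slope_zero
    simpa [Function.comp_def] using h1.comp ht

lemma stronglyMeasurable_lineDeriv_fst {f : Eucl n → Eucl n → F}
    {v : Eucl n} (hf : StronglyMeasurable fun p : Eucl n × Eucl n => f p.1 p.2)
    (hd : ∀ η y, LineDifferentiableAt ℝ (fun y => f y η) y v) :
    StronglyMeasurable fun p : Eucl n × Eucl n => lineDeriv ℝ (fun y => f y p.2) p.1 v :=
  (stronglyMeasurable_lineDeriv_snd (f := fun η y => f y η)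
    (hf.comp_measurable measurable_swap) hd).comp_measurable measurable_swap

variable {V W U : Type*} [NormedAddCommGroup V] [NormedSpace ℝ V] [NormedAddCommGroup W]
  [NormedSpace ℝ W] [NormedAddCommGroup U] [NormedSpace ℝ U]

lemma integrable_bilin {A : Eucl n → V} (hA : AEStronglyMeasurable A volume) {C : ℝ}
    (hC : ∀ x, ‖A x‖ ≤ C) {f : Eucl n → W} (hf : Integrable f) (B : V →L[ℝ] W →L[ℝ] U) :
    Integrable fun x => B (A x) (f x) := by
  refine (hf.norm.const_mul (‖B‖ * C)).mono' (B.aestronglyMeasurable_comp₂ hA hf.1)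
    (.of_forall fun x => ?_)
  refine (B.le_opNorm₂ _ _).trans ?_
  have := hC x
  gcongr

lemma hasLineDerivAt_schwartz (f : 𝓢(Eucl n, W)) (v x : Eucl n) :
    HasLineDerivAt ℝ f ((∂_{v} f : 𝓢(Eucl n, W)) x) x v := by
  rw [SchwartzMap.lineDerivOp_apply]
  exact (f.differentiableAt.lineDifferentiableAt).hasLineDerivAt

lemma integral_bilin_lineDerivOp_iterate {v : Eucl n} (B : V →L[ℝ] W →L[ℝ] U) (f : 𝓢(Eucl n, W))
    {C : ℝ} (N : ℕ) {A : ℕ → Eucl n → V} (hm : ∀ a ≤ N, AEStronglyMeasurable (A a) volume)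
    (hC : ∀ a ≤ N, ∀ x, ‖A a x‖ ≤ C) (hd : ∀ a < N, ∀ x, HasLineDerivAt ℝ (A a) (A (a + 1) x) x v) :
    ∫ x, B (A 0 x) (((∂_{v})^[N] f) x) = (-1 : ℝ) ^ N • ∫ x, B (A N x) (f x) := by
  induction N generalizing A with
  | zero => simp
  | succ N ih =>
    -- The induction hypothesis is applied to the shifted sequence A₁, A₂, …; one more integration
    -- by parts moves the remaining derivative from f to A₀.
    have h1 := ih (A := fun a => A (a + 1)) (fun a ha => hm _ (by omega)) (fun a ha => hC _ (by omega))
      (fun a ha => hd _ (by omega))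
    rw [pow_succ', mul_smul, ← h1, neg_one_smul]
    simp only [Function.iterate_succ_apply', zero_add]
    refine integral_bilinear_hasLineDerivAt_right_eq_neg_left_of_integrable (v := v)
      ?_ ?_ ?_ (fun x _ => hd 0 (by omega) x) (fun x _ => hasLineDerivAt_schwartz _ v x)
    · exact integrable_bilin (hm 1 (by omega)) (hC 1 (by omega)) (SchwartzMap.integrable _) B
    · exact integrable_bilin (hm 0 (by omega)) (hC 0 (by omega)) (SchwartzMap.integrable _) B
    · exact integrable_bilin (hm 0 (by omega)) (hC 0 (by omega)) (SchwartzMap.integrable _) B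

/-- The Leibniz formula for the `a`-th derivative of `B(A, h)`, given the derivatives of `A`
and `h`. -/
def leibniz {X : Type*} (B : V →L[ℝ] W →L[ℝ] U) (A : ℕ → X → V) (h : ℕ → X → W) (a : ℕ)
    (x : X) : U :=
  ∑ p ∈ Finset.HasAntidiagonal.antidiagonal a, a.choose p.1 • B (A p.1 x) (h p.2 x)

lemma leibniz_zero {X : Type*} (B : V →L[ℝ] W →L[ℝ] U) (A : ℕ → X → V) (h : ℕ → X → W) (x : X) :
    leibniz B A h 0 x = B (A 0 x) (h 0 x) := by simp [leibniz]

/-- The product rule on each term, recombined by Pascal's identity. -/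
lemma hasLineDerivAt_leibniz (B : V →L[ℝ] W →L[ℝ] U) {A : ℕ → Eucl n → V} {h : ℕ → Eucl n → W}
    {v : Eucl n} {N a : ℕ} (ha : a < N)
    (hA : ∀ a < N, ∀ x, HasLineDerivAt ℝ (A a) (A (a + 1) x) x v)
    (hh : ∀ a < N, ∀ x, HasLineDerivAt ℝ (h a) (h (a + 1) x) x v) (x : Eucl n) :
    HasLineDerivAt ℝ (leibniz B A h a) (leibniz B A h (a + 1) x) x v := by
  have h1 : ∀ p ∈ Finset.HasAntidiagonal.antidiagonal a, HasDerivAt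
      (fun t : ℝ => a.choose p.1 • B (A p.1 (x + t • v)) (h p.2 (x + t • v)))
      (a.choose p.1 • (B (A p.1 x) (h (p.2 + 1) x) + B (A (p.1 + 1) x) (h p.2 x))) 0 := by
    intro p hp
    have hp' := Finset.HasAntidiagonal.mem_antidiagonal.1 hp
    have h2 := B.hasDerivAt_of_bilinear (fun _ => hA p.1 (by omega) x) (fun _ => hh p.2 (by omega) x)
    simp only [zero_smul, add_zero] at h2
    exact h2.const_smul (a.choose p.1)
  have h3 := HasDerivAt.fun_sum h1
  refine h3.congr_deriv ?_
  rw [leibniz, Finset.sum_antidiagonal_choose_succ_nsmul (fun i j => B (A i x) (h j x))]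
  simp only [smul_add, Finset.sum_add_distrib]
  congr 1
  refine Finset.sum_congr rfl fun p hp => ?_
  rw [Nat.choose_symm_of_eq_add (Finset.HasAntidiagonal.mem_antidiagonal.1 hp).symm]

end Calculus

/-! ### Pure derivatives of the symbol: bounds, continuity, measurability. -/

section Symbol

variable {n : ℕ} {F : Type*} [NormedAddCommGroup F] [NormedSpace ℝ F]

lemma word_single (i : Fin n) (a : ℕ) : word (Pi.single i a) = List.replicate a i := by
  have hl : (word (Pi.single i a : Fin n → ℕ)).length = a := by
    rw [word, List.length_flatten, List.map_ofFn, List.sum_ofFn]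
    simp
  refine (List.eq_replicate_iff).2 ⟨hl, fun j hj => ?_⟩
  rw [word, List.mem_flatten] at hj
  obtain ⟨l, hl, hj⟩ := hj
  obtain ⟨k, rfl⟩ := List.mem_ofFn.1 hl
  obtain ⟨h0, rfl⟩ := List.mem_replicate.1 hj
  by_contra hne
  exact h0 (Pi.single_eq_of_ne hne _)

lemma order_single (i : Fin n) (a : ℕ) : order (Pi.single i a) = a := by
  simp [order]

/-- `∂_{y_j}^a ∂_{η_i}^b L`. -/
def pureMixed (L : Eucl n → Eucl n → F) (j : Fin n) (a : ℕ) (i : Fin n) (b : ℕ) (y η : Eucl n) : F :=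
  iterPartial (List.replicate a j) (fun y' => iterPartial (List.replicate b i) (L y') η) y

lemma pureMixed_eq (L : Eucl n → Eucl n → F) (j i : Fin n) (a b : ℕ) (y η : Eucl n) :
    pureMixed L j a i b y η = mixedPartial (Pi.single j a) (Pi.single i b) L y η := by
  simp only [mixedPartial, multiPartial, word_single, pureMixed]

lemma hasLineDerivAt_iterPartial {i : Fin n} {a : ℕ} {f : Eucl n → F}
    (h : IterPartialExists (List.replicate (a + 1) i) f) (x : Eucl n) :
    HasLineDerivAt ℝ (iterPartial (List.replicate a i) f)
      (iterPartial (List.replicate (a + 1) i) f x) x (EuclideanSpace.single i 1) :=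
  (h.2 x).hasLineDerivAt

variable {k : ℕ} {L : Eucl n → Eucl n → F}

lemma norm_mixedPartial_le (hB : symbolSeminorm k L < ∞) {α β : Fin n → ℕ} (hα : order α ≤ k)
    (hβ : order β ≤ k) (y η : Eucl n) :
    ‖mixedPartial α β L y η‖ ≤ (symbolSeminorm k L).toReal := by
  rw [← toReal_enorm]
  refine ENNReal.toReal_mono hB.ne ?_
  exact le_iSup_of_le α <| le_iSup_of_le β <| le_iSup_of_le hα <| le_iSup_of_le hβ <|
    le_iSup_of_le y <| le_iSup_of_le η le_rfl

lemma norm_symbol_le (hB : symbolSeminorm k L < ∞) (y η : Eucl n) :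
    ‖L y η‖ ≤ (symbolSeminorm k L).toReal := by
  have h := norm_mixedPartial_le hB (α := 0) (β := 0) (by simp [order]) (by simp [order]) y η
  have hw : word (0 : Fin n → ℕ) = [] := by simp [word]
  simpa [mixedPartial, multiPartial, hw, iterPartial] using h

lemma norm_pureMixed_le (hB : symbolSeminorm k L < ∞) (j i : Fin n) {a b : ℕ} (ha : a ≤ k)
    (hb : b ≤ k) (y η : Eucl n) : ‖pureMixed L j a i b y η‖ ≤ (symbolSeminorm k L).toReal := by
  rw [pureMixed_eq]
  exact norm_mixedPartial_le hB (by rwa [order_single]) (by rwa [order_single]) y η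

/-- Only zero y-derivatives are allowed here: in ∂_y^α ∂_η^β L the η-derivatives are taken first. -/
lemma hasLineDerivAt_pureMixed_right (hL : MixedPartialsExist k L) (j i : Fin n) {b : ℕ}
    (hb : b < k) (y η : Eucl n) :
    HasLineDerivAt ℝ (fun η => pureMixed L j 0 i b y η) (pureMixed L j 0 i (b + 1) y η) η
      (EuclideanSpace.single i 1) := by
  have h := (hL 0 (Pi.single i (b + 1)) (by simp [order]) (by rw [order_single]; exact hb)).1 y
  rw [MultiPartialExists, word_single] at h
  exact hasLineDerivAt_iterPartial h η

lemma hasLineDerivAt_pureMixed_left (hL : MixedPartialsExist k L) (j i : Fin n) {a b : ℕ}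
    (ha : a < k) (hb : b ≤ k) (y η : Eucl n) :
    HasLineDerivAt ℝ (fun y => pureMixed L j a i b y η) (pureMixed L j (a + 1) i b y η) y
      (EuclideanSpace.single j 1) := by
  have h := (hL (Pi.single j (a + 1)) (Pi.single i b) (by rw [order_single]; exact ha)
    (by rwa [order_single])).2 η
  simp only [MultiPartialExists, multiPartial, word_single] at h
  exact hasLineDerivAt_iterPartial h y

/-- Bounded first partial derivatives make L Lipschitz in each variable, uniformly in the other,
hence jointly continuous. -/
lemma continuous_symbol (hk : 0 < k) (hL : MixedPartialsExist k L) (hB : symbolSeminorm k L < ∞) :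
    Continuous fun p : Eucl n × Eucl n => L p.1 p.2 := by
  set B := (symbolSeminorm k L).toReal
  have h1 : ∀ y η η', ‖L y η - L y η'‖ ≤ B * ∑ i, |η i - η' i| := fun y =>
    norm_sub_le_of_lineDeriv_le (f := L y) (f' := fun i η => pureMixed L i 0 i 1 y η)
      (fun i z => hasLineDerivAt_pureMixed_right hL i i hk y z)
      (fun i z => norm_pureMixed_le hB i i (Nat.zero_le _) hk y z)
  have h2 : ∀ η y y', ‖L y η - L y' η‖ ≤ B * ∑ i, |y i - y' i| := fun η =>
    norm_sub_le_of_lineDeriv_le (f := fun y => L y η) (f' := fun i y => pureMixed L i 1 i 0 y η)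
      (fun i z => hasLineDerivAt_pureMixed_left hL i i hk (Nat.zero_le _) z η)
      (fun i z => norm_pureMixed_le hB i i hk (Nat.zero_le _) z η)
  refine continuous_iff_continuousAt.2 fun p => ?_
  rw [ContinuousAt, tendsto_iff_norm_sub_tendsto_zero]
  have hc : Filter.Tendsto (fun q : Eucl n × Eucl n =>
      B * ∑ i, |q.2 i - p.2 i| + B * ∑ i, |q.1 i - p.1 i|) (nhds p) (nhds 0) := by
    have : Continuous (fun q : Eucl n × Eucl n =>
      B * ∑ i, |q.2 i - p.2 i| + B * ∑ i, |q.1 i - p.1 i|) := by fun_prop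
    simpa using this.tendsto p
  refine squeeze_zero (fun _ => norm_nonneg _) (fun q => ?_) hc
  exact (norm_sub_le_norm_sub_add_norm_sub _ (L q.1 p.2) _).trans
    (add_le_add (h1 _ _ _) (h2 _ _ _))

lemma stronglyMeasurable_pureMixed (hk : 0 < k) (hL : MixedPartialsExist k L) (hB : symbolSeminorm k L < ∞)
    (j i : Fin n) {a b : ℕ} (ha : a ≤ k) (hb : b ≤ k) :
    StronglyMeasurable fun p : Eucl n × Eucl n => pureMixed L j a i b p.1 p.2 := by
  -- The order of differentiation dictates the induction: η-derivatives are built up at a = 0, then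
  -- y-derivatives are added.
  induction a with
  | zero =>
    induction b with
    | zero =>
      exact (continuous_symbol hk hL hB).stronglyMeasurable
    | succ b ih =>
      exact stronglyMeasurable_lineDeriv_snd (f := fun y η => pureMixed L j 0 i b y η)
        (ih (by omega)) fun y η =>
          (hasLineDerivAt_pureMixed_right hL j i hb y η).lineDifferentiableAt
  | succ a ih =>
    exact stronglyMeasurable_lineDeriv_fst (f := fun y η => pureMixed L j a i b y η)
      (ih (by omega)) fun η y =>
        (hasLineDerivAt_pureMixed_left hL j i ha hb y η).lineDifferentiableAt

end Symbol

/-! ### Successive derivatives of the weight and of its windowed transforms. -/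

section WeightDerivatives

variable {n : ℕ}

/-- A sequence of functions in `wtSpan m j` starting at the weight `wt m`, each being minus the
`j`-th partial derivative of the preceding one. -/
def wtSeq (m : ℕ) (j : Fin n) : ℕ → wtSpan m j
  | 0 => ⟨wt m, wt_mem_wtSpan m j⟩
  | b + 1 => -⟨_, (exists_hasLineDerivAt_of_mem_wtSpan (wtSeq m j b).2).choose_spec.1⟩

lemma hasLineDerivAt_wtSeq (m : ℕ) (j : Fin n) (b : ℕ) (z : Eucl n) :
    HasLineDerivAt ℝ (wtSeq m j b : Eucl n → ℝ) (-(wtSeq m j (b + 1) : Eucl n → ℝ) z) z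
      (EuclideanSpace.single j 1) := by
  have h := (exists_hasLineDerivAt_of_mem_wtSpan (wtSeq m j b).2).choose_spec.2 z
  have e : ((wtSeq m j (b + 1) : wtSpan m j) : Eucl n → ℝ) z =
    -(exists_hasLineDerivAt_of_mem_wtSpan (wtSeq m j b).2).choose z := rfl
  rwa [e, neg_neg]

lemma hasTemperateGrowth_wtSeq (m : ℕ) (j : Fin n) (b : ℕ) :
    Function.HasTemperateGrowth (wtSeq m j b : Eucl n → ℝ) :=
  hasTemperateGrowth_of_mem_wtSpan (wtSeq m j b).2

lemma exists_abs_wtSeq_le (m : ℕ) (j : Fin n) (b : ℕ) :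
    ∃ C : ℝ, ∀ z, |(wtSeq m j b : Eucl n → ℝ) z| ≤ C := by
  obtain ⟨C, hC, h⟩ := exists_abs_le_of_mem_wtSpan (wtSeq m j b).2
  exact ⟨C, fun z => (h z).trans (mul_le_of_le_one_right hC (wt_le_one m z))⟩

lemma memLp_wtSeq {m : ℕ} (hm : n < 4 * m) (j : Fin n) (b : ℕ) :
    MemLp (wtSeq m j b : Eucl n → ℝ) 2 volume := by
  obtain ⟨C, hC, h⟩ := exists_abs_le_of_mem_wtSpan (wtSeq m j b).2
  refine MemLp.of_le_mul (c := C) (memLp_wt hm)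
    (hasTemperateGrowth_wtSeq m j b).1.continuous.aestronglyMeasurable (.of_forall fun z => ?_)
  rw [Real.norm_eq_abs, Real.norm_eq_abs, abs_of_pos (wt_pos m z)]
  exact h z

lemma abs_wt_le_one (m : ℕ) (z : Eucl n) : |wt m z| ≤ 1 := by
  rw [abs_of_pos (wt_pos m z)]
  exact wt_le_one m z

variable {H : Type*} [NormedAddCommGroup H] [InnerProductSpace ℂ H]

/-- The sign built into `wtSeq` cancels the one from differentiating q(z - y), so no signs appear in
the Leibniz sums. -/
lemma hasLineDerivAt_windowFourier_wtSeq (m : ℕ) (j : Fin n) (b : ℕ) (w : 𝓢(Eucl n, H))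
    (y ξ : Eucl n) :
    HasLineDerivAt ℝ (fun y => windowFourier (wtSeq m j b) w y ξ)
      (windowFourier (wtSeq m j (b + 1)) w y ξ) y (EuclideanSpace.single j 1) := by
  obtain ⟨C, hC⟩ := exists_abs_wtSeq_le m j b
  obtain ⟨D, hD⟩ := exists_abs_wtSeq_le m j (b + 1)
  have h := hasLineDerivAt_windowFourier (hasTemperateGrowth_wtSeq m j b).1.continuous
    (hasTemperateGrowth_wtSeq m j (b + 1)).1.continuous.neg (C := max C D)
    (fun z => (hC z).trans (le_max_left _ _))
    (fun z => by rw [Pi.neg_apply, abs_neg]; exact (hD z).trans (le_max_right _ _))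
    (hasLineDerivAt_wtSeq m j b) w y ξ
  simpa only [Pi.neg_apply, neg_neg] using h

lemma norm_windowFourier_le {q : Eucl n → ℝ} {C : ℝ} (hC : ∀ z, |q z| ≤ C) (w : 𝓢(Eucl n, H))
    (y ξ : Eucl n) : ‖windowFourier q w y ξ‖ ≤ C * ∫ z, ‖w z‖ := by
  rw [← integral_const_mul]
  refine norm_integral_le_of_norm_le (w.integrable.norm.const_mul C) (.of_forall fun z => ?_)
  rw [Circle.norm_smul, norm_smul]
  exact mul_le_mul_of_nonneg_right (hC _) (norm_nonneg _)

end WeightDerivatives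

/-! ### The symbol after the integration by parts in ξ. -/

section Reduced

variable {n : ℕ} {F : Type*} [NormedAddCommGroup F] [NormedSpace ℝ F]

/-- The symbol `(1 ± ∑ᵢ ∂_{ηᵢ}^{2m}) L`, evaluated at `(y, 2πξ)`. -/
def redSymbol (m : ℕ) (L : Eucl n → Eucl n → F) (y ξ : Eucl n) : F :=
  L y ((2 * Real.pi) • ξ) +
    (-1 : ℝ) ^ m • ∑ i, iterPartial (List.replicate (2 * m) i) (L y) ((2 * Real.pi) • ξ)

/-- The derivative `∂_{y_j}^a` of `redSymbol m L`. -/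
def redSymbolDeriv (m : ℕ) (L : Eucl n → Eucl n → F) (j : Fin n) (a : ℕ) (y ξ : Eucl n) : F :=
  pureMixed L j a j 0 y ((2 * Real.pi) • ξ) +
    (-1 : ℝ) ^ m • ∑ i, pureMixed L j a i (2 * m) y ((2 * Real.pi) • ξ)

variable {k m : ℕ} {L : Eucl n → Eucl n → F}

lemma hasLineDerivAt_redSymbolDeriv (hL : MixedPartialsExist k L) (hm : 2 * m ≤ k) (j : Fin n)
    {a : ℕ} (ha : a < 2 * m) (y ξ : Eucl n) :
    HasLineDerivAt ℝ (fun y => redSymbolDeriv m L j a y ξ) (redSymbolDeriv m L j (a + 1) y ξ) y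
      (EuclideanSpace.single j 1) := by
  have h1 := hasLineDerivAt_pureMixed_left hL j j (ha.trans_le hm) (Nat.zero_le _) y
    ((2 * Real.pi) • ξ)
  have h2 : ∀ i ∈ Finset.univ, _ := fun i _ =>
    hasLineDerivAt_pureMixed_left hL j i (ha.trans_le hm) hm y ((2 * Real.pi) • ξ)
  exact HasDerivAt.add h1 ((HasDerivAt.fun_sum h2).const_smul ((-1 : ℝ) ^ m))

lemma norm_add_sum_le {B : ℝ} {x : F} {f : Fin n → F} (hx : ‖x‖ ≤ B) (hf : ∀ i, ‖f i‖ ≤ B) :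
    ‖x + (-1 : ℝ) ^ m • ∑ i, f i‖ ≤ (n + 1) * B := by
  calc ‖x + (-1 : ℝ) ^ m • ∑ i, f i‖ ≤ ‖x‖ + ‖∑ i, f i‖ := by
        refine (norm_add_le _ _).trans ?_
        rw [norm_smul, norm_pow, norm_neg, norm_one, one_pow, one_mul]
    _ ≤ B + ∑ _i : Fin n, B := add_le_add hx (norm_sum_le_of_le _ fun i _ => hf i)
    _ = _ := by simp; ring

lemma norm_redSymbolDeriv_le (hB : symbolSeminorm k L < ∞) (hm : 2 * m ≤ k) (j : Fin n) {a : ℕ}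
    (ha : a ≤ 2 * m) (y ξ : Eucl n) :
    ‖redSymbolDeriv m L j a y ξ‖ ≤ (n + 1) * (symbolSeminorm k L).toReal :=
  norm_add_sum_le (norm_pureMixed_le hB j j (ha.trans hm) (Nat.zero_le _) _ _)
    fun i => norm_pureMixed_le hB j i (ha.trans hm) hm _ _

lemma norm_redSymbol_le (hB : symbolSeminorm k L < ∞) (hm : 2 * m ≤ k) (y ξ : Eucl n) :
    ‖redSymbol m L y ξ‖ ≤ (n + 1) * (symbolSeminorm k L).toReal :=
  norm_add_sum_le (norm_symbol_le hB _ _)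
    fun i => norm_pureMixed_le hB i i (Nat.zero_le _) hm y _

lemma stronglyMeasurable_comp_dilation {G : Type*} [NormedAddCommGroup G] {f : Eucl n → Eucl n → G}
    (hf : StronglyMeasurable fun p : Eucl n × Eucl n => f p.1 p.2) :
    StronglyMeasurable fun p : Eucl n × Eucl n => f p.1 ((2 * Real.pi) • p.2) :=
  hf.comp_measurable (g := fun p : Eucl n × Eucl n => (p.1, (2 * Real.pi) • p.2)) (by fun_prop)

lemma stronglyMeasurable_redSymbolDeriv (hk : 0 < k) (hL : MixedPartialsExist k L)
    (hB : symbolSeminorm k L < ∞) (hm : 2 * m ≤ k) (j : Fin n) {a : ℕ} (ha : a ≤ 2 * m) :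
    StronglyMeasurable fun p : Eucl n × Eucl n => redSymbolDeriv m L j a p.1 p.2 := by
  refine (stronglyMeasurable_comp_dilation (stronglyMeasurable_pureMixed hk hL hB j j
    (ha.trans hm) (Nat.zero_le _))).add (StronglyMeasurable.const_smul ?_ _)
  refine Finset.stronglyMeasurable_fun_sum _ fun i _ => ?_
  exact stronglyMeasurable_comp_dilation (stronglyMeasurable_pureMixed hk hL hB j i (ha.trans hm) hm)

lemma stronglyMeasurable_redSymbol (hk : 0 < k) (hL : MixedPartialsExist k L)
    (hB : symbolSeminorm k L < ∞) (hm : 2 * m ≤ k) :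
    StronglyMeasurable fun p : Eucl n × Eucl n => redSymbol m L p.1 p.2 := by
  refine (stronglyMeasurable_comp_dilation
    (continuous_symbol hk hL hB).stronglyMeasurable).add (StronglyMeasurable.const_smul ?_ _)
  refine Finset.stronglyMeasurable_fun_sum _ fun i _ => ?_
  exact stronglyMeasurable_comp_dilation
    (stronglyMeasurable_pureMixed hk hL hB i i (Nat.zero_le _) hm)

end Reduced

/-! ### Integration by parts in ξ. -/

section Pairing

variable {n : ℕ} {H : Type*} [NormedAddCommGroup H] [InnerProductSpace ℂ H]

variable (H) in
/-- Evaluation of operators as a real bilinear map. -/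
def applyBilin : (H →L[ℂ] H) →L[ℝ] H →L[ℝ] H :=
  ContinuousLinearMap.restrictScalarsL ℂ H H ℝ ℝ

lemma applyBilin_apply (A : H →L[ℂ] H) (x : H) : applyBilin H A x = A x := rfl

variable (H) in
/-- The map `(x, y) ↦ ⟪y, x⟫` as a real bilinear map. -/
def innerBilin : H →L[ℝ] H →L[ℝ] ℂ :=
  (isBoundedBilinearMap_inner (𝕜 := ℂ) (E := H)).toContinuousLinearMap.flip

lemma innerBilin_apply (x y : H) : innerBilin H x y = inner ℂ y x := rfl

variable {k m : ℕ} {L : Eucl n → Eucl n → (H →L[ℂ] H)}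

lemma ellipOp_apply (m : ℕ) (f : 𝓢(Eucl n, H)) (x : Eucl n) :
    ellipOp m f x =
      f x + ∑ i, ellipConst m • ((∂_{(EuclideanSpace.single i (1 : ℝ) : Eucl n)})^[2 * m] f) x := by
  simp [ellipOp, add_apply, sum_apply]

/-- Each ∂_{ξ_i}^{2m} is moved onto ξ ↦ L(y, 2πξ); the chain-rule factor (2π)^{2m} cancels the one
in `ellipConst`, leaving (-1)^m. -/
lemma integral_symbol_ellipOp (hk : 0 < k) (hL : MixedPartialsExist k L)
    (hB : symbolSeminorm k L < ∞) (hm : 2 * m ≤ k) (y : Eucl n) (f : 𝓢(Eucl n, H)) :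
    ∫ ξ, L y ((2 * Real.pi) • ξ) (ellipOp m f ξ) = ∫ ξ, redSymbol m L y ξ (f ξ) := by
  set B := (symbolSeminorm k L).toReal
  have hsec : ∀ {g : Eucl n → Eucl n → (H →L[ℂ] H)},
      StronglyMeasurable (fun p : Eucl n × Eucl n => g p.1 p.2) →
      AEStronglyMeasurable (fun ξ => g y ((2 * Real.pi) • ξ)) volume := fun hg =>
    ((stronglyMeasurable_comp_dilation hg).comp_measurable measurable_prodMk_left).aestronglyMeasurable
  have hpm : ∀ i {b : ℕ}, b ≤ k → AEStronglyMeasurable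
      (fun ξ => pureMixed L i 0 i b y ((2 * Real.pi) • ξ)) volume := fun i b hb =>
    hsec (stronglyMeasurable_pureMixed hk hL hB i i (Nat.zero_le _) hb)
  have hL0 := hsec (continuous_symbol hk hL hB).stronglyMeasurable
  have I0 : ∀ g : 𝓢(Eucl n, H), Integrable fun ξ => L y ((2 * Real.pi) • ξ) (g ξ) := fun g =>
    integrable_bilin hL0 (fun ξ => norm_symbol_le hB y _) g.integrable (applyBilin H)
  have I1 : ∀ i, Integrable fun ξ => pureMixed L i 0 i (2 * m) y ((2 * Real.pi) • ξ) (f ξ) :=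
    fun i => integrable_bilin (hpm i hm) (fun ξ => norm_pureMixed_le hB i i (Nat.zero_le _) hm y _)
      f.integrable (applyBilin H)
  have key : ∀ i, ∫ ξ, L y ((2 * Real.pi) • ξ)
        (((∂_{(EuclideanSpace.single i (1 : ℝ) : Eucl n)})^[2 * m] f) ξ) =
      (2 * Real.pi) ^ (2 * m) • ∫ ξ, pureMixed L i 0 i (2 * m) y ((2 * Real.pi) • ξ) (f ξ) := by
    intro i
    have h := integral_bilin_lineDerivOp_iterate (v := EuclideanSpace.single i (1 : ℝ))
      (applyBilin H) f (2 * m) (C := (2 * Real.pi) ^ (2 * m) * B)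
      (A := fun b ξ => (2 * Real.pi) ^ b • pureMixed L i 0 i b y ((2 * Real.pi) • ξ))
      (fun b hb => (hpm i (hb.trans hm)).fun_const_smul _) (fun b hb ξ => ?_) (fun b hb ξ => ?_)
    · simp only [map_smul, applyBilin_apply, (even_two_mul m).neg_one_pow, one_smul, pow_zero,
        smul_apply] at h
      rw [integral_smul] at h
      exact h
    · rw [norm_smul, norm_pow, Real.norm_of_nonneg (by positivity)]
      have h1 : 1 ≤ 2 * Real.pi := by linarith [Real.pi_gt_three]
      have h2 := norm_pureMixed_le hB i i (Nat.zero_le _) (hb.trans hm) y ((2 * Real.pi) • ξ)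
      gcongr
    · have h1 := (hasDerivAt_line (hasLineDerivAt_pureMixed_right hL i i (hb.trans_le hm) y)
        ((2 * Real.pi) • ξ) (2 * Real.pi * 0))
      have h2 := (h1.scomp (0 : ℝ) ((hasDerivAt_id' (0 : ℝ)).const_mul (2 * Real.pi))).fun_const_smul
        ((2 * Real.pi) ^ b)
      simp only [Function.comp_def, mul_zero, zero_smul, add_zero, mul_one, smul_smul,
        ← pow_succ] at h2
      simpa only [HasLineDerivAt, smul_add, smul_smul] using h2
  have hc : ellipConst m * (2 * Real.pi) ^ (2 * m) = (-1) ^ m := by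
    rw [ellipConst, mul_assoc, inv_mul_cancel₀ (by positivity), mul_one]
  calc ∫ ξ, L y ((2 * Real.pi) • ξ) (ellipOp m f ξ)
      = ∫ ξ, (L y ((2 * Real.pi) • ξ) (f ξ) + ∑ i, ellipConst m • L y ((2 * Real.pi) • ξ)
        (((∂_{(EuclideanSpace.single i (1 : ℝ) : Eucl n)})^[2 * m] f) ξ)) := by
        refine integral_congr_ae (.of_forall fun ξ => ?_)
        simp only [ellipOp_apply, map_add, map_sum]
        congr 1
        exact Finset.sum_congr rfl fun i _ => (applyBilin H (L y ((2 * Real.pi) • ξ))).map_smul _ _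
    _ = (∫ ξ, L y ((2 * Real.pi) • ξ) (f ξ)) + ∑ i, (-1 : ℝ) ^ m •
        ∫ ξ, pureMixed L i 0 i (2 * m) y ((2 * Real.pi) • ξ) (f ξ) := by
        rw [integral_add (I0 f) (integrable_finsetSum _ fun i _ => (I0 _).fun_smul _),
          integral_finsetSum _ fun i _ => (I0 _).fun_smul _]
        congr 1
        refine Finset.sum_congr rfl fun i _ => ?_
        rw [integral_smul, key, smul_smul, hc]
    _ = ∫ ξ, (L y ((2 * Real.pi) • ξ) (f ξ) + ∑ i, (-1 : ℝ) ^ m •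
        pureMixed L i 0 i (2 * m) y ((2 * Real.pi) • ξ) (f ξ)) := by
        rw [integral_add (I0 f) (integrable_finsetSum _ fun i _ => (I1 i).fun_smul _),
          integral_finsetSum _ fun i _ => (I1 i).fun_smul _]
        simp only [integral_smul]
    _ = _ := by
        refine integral_congr_ae (.of_forall fun ξ => ?_)
        simp only [redSymbol, add_apply, smul_apply,
          sum_apply, Finset.smul_sum]
        rfl

end Pairing

/-! ### The kernel produced by integration by parts in y, and its L² bound. -/

section Pairing

variable {n : ℕ} {H : Type*} [NormedAddCommGroup H] [InnerProductSpace ℂ H]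

variable {k m : ℕ} {L : Eucl n → Eucl n → (H →L[ℂ] H)}

/-- The function obtained from `redSymbol m L y ξ (windowFourier (wt m) u y ξ)` by applying
`1 + c ∑ ∂_{y_j}^{2m}`. -/
def redKernel (m : ℕ) (L : Eucl n → Eucl n → (H →L[ℂ] H)) (u : Eucl n → H) (y ξ : Eucl n) : H :=
  redSymbol m L y ξ (windowFourier (wt m) u y ξ) +
    ∑ j, ellipConst m • leibniz (applyBilin H) (fun a y => redSymbolDeriv m L j a y ξ)
      (fun b y => windowFourier (wtSeq m j b) u y ξ) (2 * m) y

variable (n) in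
/-- The constant bounding the `L²` norm of `redKernel`. -/
def kernelConst (m : ℕ) : ℝ≥0∞ :=
  eLpNorm (wt m : Eucl n → ℝ) 2 volume + ∑ j : Fin n, ‖ellipConst m‖ₑ *
    ∑ p ∈ Finset.HasAntidiagonal.antidiagonal (2 * m),
      ((2 * m).choose p.1 : ℝ≥0∞) * eLpNorm (wtSeq m j p.2 : Eucl n → ℝ) 2 volume

lemma kernelConst_lt_top (hm : n < 4 * m) : kernelConst n m < ∞ := by
  refine ENNReal.add_lt_top.2 ⟨(memLp_wt hm).2, ENNReal.sum_lt_top.2 fun j _ => ?_⟩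
  refine ENNReal.mul_lt_top enorm_lt_top (ENNReal.sum_lt_top.2 fun p _ => ?_)
  exact ENNReal.mul_lt_top (ENNReal.natCast_lt_top _) (memLp_wtSeq hm j p.2).2

lemma continuous_windowFourier_wt (m : ℕ) (u : 𝓢(Eucl n, H)) :
    Continuous (fun p : Eucl n × Eucl n => windowFourier (wt m) u p.1 p.2) :=
  continuous_windowFourier (hasTemperateGrowth_wt m).1.continuous (abs_wt_le_one m) u

lemma continuous_windowFourier_wtSeq (m : ℕ) (j : Fin n) (b : ℕ) (u : 𝓢(Eucl n, H)) :
    Continuous (fun p : Eucl n × Eucl n => windowFourier (wtSeq m j b) u p.1 p.2) := by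
  obtain ⟨C, hC⟩ := exists_abs_wtSeq_le m j b
  exact continuous_windowFourier (hasTemperateGrowth_wtSeq m j b).1.continuous hC u

lemma stronglyMeasurable_apply {X : Type*} [MeasurableSpace X] {A : X → (H →L[ℂ] H)} {f : X → H}
    (hA : StronglyMeasurable A) (hf : StronglyMeasurable f) :
    StronglyMeasurable fun x => A x (f x) :=
  (isBoundedBilinearMap_apply (𝕜 := ℂ) (E := H) (F := H)).continuous.comp_stronglyMeasurable
    (hA.prodMk hf)

lemma stronglyMeasurable_leibniz_term (hk : 0 < k) (hL : MixedPartialsExist k L)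
    (hB : symbolSeminorm k L < ∞) (hm : 2 * m ≤ k) (u : 𝓢(Eucl n, H)) (j : Fin n)
    {p : ℕ × ℕ} (hp : p.1 ≤ 2 * m) (c : ℕ) :
    StronglyMeasurable fun x : Eucl n × Eucl n =>
      c • redSymbolDeriv m L j p.1 x.1 x.2 (windowFourier (wtSeq m j p.2) u x.1 x.2) :=
  (stronglyMeasurable_apply (stronglyMeasurable_redSymbolDeriv hk hL hB hm j hp)
    (continuous_windowFourier_wtSeq m j p.2 u).stronglyMeasurable).fun_const_smul _

lemma stronglyMeasurable_leibniz (hk : 0 < k) (hL : MixedPartialsExist k L)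
    (hB : symbolSeminorm k L < ∞) (hm : 2 * m ≤ k) (u : 𝓢(Eucl n, H)) (j : Fin n)
    {a : ℕ} (ha : a ≤ 2 * m) :
    StronglyMeasurable fun x : Eucl n × Eucl n =>
      leibniz (applyBilin H) (fun a y => redSymbolDeriv m L j a y x.2)
        (fun b y => windowFourier (wtSeq m j b) u y x.2) a x.1 :=
  Finset.stronglyMeasurable_fun_sum _ fun p hp => stronglyMeasurable_leibniz_term hk hL hB hm u j
    ((Finset.HasAntidiagonal.mem_antidiagonal.1 hp ▸ Nat.le_add_right _ _ : p.1 ≤ a).trans ha) _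

/-- A qualitative bound: it only supplies integrability for the integration by parts, and its
constant does not enter the final estimate. -/
lemma exists_norm_leibniz_le (hB : symbolSeminorm k L < ∞) (hm : 2 * m ≤ k) (u : 𝓢(Eucl n, H))
    (j : Fin n) : ∃ C, ∀ a ≤ 2 * m, ∀ y ξ,
      ‖leibniz (applyBilin H) (fun a y => redSymbolDeriv m L j a y ξ)
        (fun b y => windowFourier (wtSeq m j b) u y ξ) a y‖ ≤ C := by
  set B := (n + 1) * (symbolSeminorm k L).toReal
  set J := ∫ z, ‖u z‖
  have hB0 : 0 ≤ B := by positivity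
  have hJ0 : 0 ≤ J := integral_nonneg fun _ => norm_nonneg _
  choose D hD using fun b => exists_abs_wtSeq_le m j b
  let T : ℕ → ℝ := fun a => ∑ p ∈ Finset.HasAntidiagonal.antidiagonal a,
    (a.choose p.1 : ℝ) * (B * (D p.2 * J))
  have hD0 : ∀ b, 0 ≤ D b := fun b => (abs_nonneg _).trans (hD b 0)
  have hT : ∀ a, 0 ≤ T a := fun a => Finset.sum_nonneg fun p _ => by
    have := hD0 p.2
    positivity
  refine ⟨∑ a ∈ Finset.range (2 * m + 1), T a, fun a ha y ξ => ?_⟩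
  refine le_trans (norm_sum_le_of_le _ fun p hp => ?_)
    (Finset.single_le_sum (f := T) (fun a _ => hT a) (Finset.mem_range.2 (Nat.lt_succ_of_le ha)))
  have hp1 : p.1 ≤ 2 * m :=
    (Finset.HasAntidiagonal.mem_antidiagonal.1 hp ▸ Nat.le_add_right _ _ : p.1 ≤ a).trans ha
  rw [← Nat.cast_smul_eq_nsmul ℝ, norm_smul, Real.norm_natCast]
  gcongr
  exact (redSymbolDeriv m L j p.1 y ξ).le_of_opNorm_le_of_le
    (norm_redSymbolDeriv_le hB hm j hp1 y ξ) (norm_windowFourier_le (hD p.2) u y ξ)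

lemma stronglyMeasurable_redKernel (hk : 0 < k) (hL : MixedPartialsExist k L)
    (hB : symbolSeminorm k L < ∞) (hm : 2 * m ≤ k) (u : 𝓢(Eucl n, H)) :
    StronglyMeasurable fun p : Eucl n × Eucl n => redKernel m L u p.1 p.2 := by
  refine (stronglyMeasurable_apply (stronglyMeasurable_redSymbol hk hL hB hm)
    (continuous_windowFourier_wt m u).stronglyMeasurable).add ?_
  refine Finset.stronglyMeasurable_fun_sum _ fun j _ => StronglyMeasurable.const_smul ?_ _
  exact stronglyMeasurable_leibniz hk hL hB hm u j le_rfl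

lemma eLpNorm_apply_le {X : Type*} [MeasurableSpace X] {μ : Measure X} {A : X → (H →L[ℂ] H)}
    {f : X → H} {B : ℝ} (hA : ∀ x, ‖A x‖ ≤ B) :
    eLpNorm (fun x => A x (f x)) 2 μ ≤ ENNReal.ofReal B * eLpNorm f 2 μ := by
  refine eLpNorm_le_mul_eLpNorm_of_ae_le_mul (.of_forall fun x => ?_) 2
  exact (A x).le_of_opNorm_le (hA x) _

/-- Every term is a uniformly bounded operator function applied to a windowed transform, whose L²
norm is known exactly. -/
lemma eLpNorm_redKernel_le [CompleteSpace H] (hk : 0 < k) (hL : MixedPartialsExist k L)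
    (hB : symbolSeminorm k L < ∞) (hm : 2 * m ≤ k) (u : 𝓢(Eucl n, H)) :
    eLpNorm (fun p : Eucl n × Eucl n => redKernel m L u p.1 p.2) 2 (volume.prod volume) ≤
      ENNReal.ofReal ((n + 1) * (symbolSeminorm k L).toReal) *
        (kernelConst n m * eLpNorm u 2 volume) := by
  set B := ENNReal.ofReal ((n + 1) * (symbolSeminorm k L).toReal)
  set μ : Measure (Eucl n × Eucl n) := volume.prod volume
  have hterm : ∀ j : Fin n, ∀ p ∈ Finset.HasAntidiagonal.antidiagonal (2 * m),
      eLpNorm (fun x : Eucl n × Eucl n => (2 * m).choose p.1 •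
        redSymbolDeriv m L j p.1 x.1 x.2 (windowFourier (wtSeq m j p.2) u x.1 x.2)) 2 μ ≤
      ((2 * m).choose p.1 : ℝ≥0∞) *
        (B * (eLpNorm (wtSeq m j p.2 : Eucl n → ℝ) 2 volume * eLpNorm u 2 volume)) := by
    intro j p hp
    have hp1 : p.1 ≤ 2 * m := Finset.HasAntidiagonal.mem_antidiagonal.1 hp ▸ Nat.le_add_right _ _
    obtain ⟨C, hC⟩ := exists_abs_wtSeq_le m j p.2
    rw [← eLpNorm_windowFourier (hasTemperateGrowth_wtSeq m j p.2) hC u]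
    have h1 := eLpNorm_apply_le (μ := μ) (f := fun x : Eucl n × Eucl n =>
      windowFourier (wtSeq m j p.2) u x.1 x.2) (fun x : Eucl n × Eucl n =>
      norm_redSymbolDeriv_le hB hm j hp1 x.1 x.2)
    simp_rw [← Nat.cast_smul_eq_nsmul ℝ]
    refine (eLpNorm_const_smul_le (c := ((2 * m).choose p.1 : ℝ))).trans ?_
    rw [Real.enorm_natCast]
    gcongr
  have hleib : ∀ j : Fin n, eLpNorm (fun x : Eucl n × Eucl n => ellipConst m •
      leibniz (applyBilin H) (fun a y => redSymbolDeriv m L j a y x.2)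
      (fun b y => windowFourier (wtSeq m j b) u y x.2) (2 * m) x.1) 2 μ ≤
      ‖ellipConst m‖ₑ * ∑ p ∈ Finset.HasAntidiagonal.antidiagonal (2 * m),
        ((2 * m).choose p.1 : ℝ≥0∞) *
        (B * (eLpNorm (wtSeq m j p.2 : Eucl n → ℝ) 2 volume * eLpNorm u 2 volume)) := by
    intro j
    refine (eLpNorm_const_smul_le (c := ellipConst m)).trans ?_
    gcongr
    refine le_trans ?_ (Finset.sum_le_sum (hterm j))
    refine le_trans (le_of_eq ?_) (eLpNorm_sum_le (fun p hp => (stronglyMeasurable_leibniz_term hk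
      hL hB hm u j (Finset.HasAntidiagonal.mem_antidiagonal.1 hp ▸
        Nat.le_add_right _ _) _).aestronglyMeasurable) one_le_two)
    congr 1
    funext x
    simp only [leibniz, applyBilin_apply, Finset.sum_apply]
  have hfirst : eLpNorm (fun x : Eucl n × Eucl n =>
      redSymbol m L x.1 x.2 (windowFourier (wt m) u x.1 x.2)) 2 μ ≤
      B * (eLpNorm (wt m : Eucl n → ℝ) 2 volume * eLpNorm u 2 volume) := by
    rw [← eLpNorm_windowFourier (hasTemperateGrowth_wt m) (abs_wt_le_one m) u]
    exact eLpNorm_apply_le fun x : Eucl n × Eucl n => norm_redSymbol_le hB hm x.1 x.2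
  have hmeas : ∀ j : Fin n, AEStronglyMeasurable (fun x : Eucl n × Eucl n => ellipConst m •
      leibniz (applyBilin H) (fun a y => redSymbolDeriv m L j a y x.2)
      (fun b y => windowFourier (wtSeq m j b) u y x.2) (2 * m) x.1) μ := fun j =>
      ((stronglyMeasurable_leibniz hk hL hB hm u j le_rfl).const_smul _).aestronglyMeasurable
  calc eLpNorm (fun p : Eucl n × Eucl n => redKernel m L u p.1 p.2) 2 μ
      ≤ eLpNorm (fun x : Eucl n × Eucl n =>
          redSymbol m L x.1 x.2 (windowFourier (wt m) u x.1 x.2)) 2 μ +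
        eLpNorm (∑ j, fun x : Eucl n × Eucl n => ellipConst m •
          leibniz (applyBilin H) (fun a y => redSymbolDeriv m L j a y x.2)
          (fun b y => windowFourier (wtSeq m j b) u y x.2) (2 * m) x.1) 2 μ := by
        refine le_trans (le_of_eq ?_) (eLpNorm_add_le (stronglyMeasurable_apply
          (stronglyMeasurable_redSymbol hk hL hB hm)
          (continuous_windowFourier_wt m u).stronglyMeasurable).aestronglyMeasurable
          (Finset.aestronglyMeasurable_sum _ fun j _ => hmeas j) one_le_two)
        congr 1
        funext x
        simp only [redKernel, Pi.add_apply, Finset.sum_apply]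
    _ ≤ _ := add_le_add hfirst ((eLpNorm_sum_le (fun j _ => hmeas j) one_le_two).trans
        (Finset.sum_le_sum fun j _ => hleib j))
    _ = _ := by
        simp only [kernelConst, add_mul, mul_add, Finset.mul_sum, Finset.sum_mul]
        congr 1
        refine Finset.sum_congr rfl fun j _ => Finset.sum_congr rfl fun p _ => ?_
        ring

lemma integral_inner_ellipOp (hk : 0 < k) (hL : MixedPartialsExist k L)
    (hB : symbolSeminorm k L < ∞) (hm : 2 * m ≤ k) (u f : 𝓢(Eucl n, H)) (ξ : Eucl n) :
    ∫ y, inner ℂ (ellipOp m f y) (redSymbol m L y ξ (windowFourier (wt m) u y ξ)) =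
      ∫ y, inner ℂ (f y) (redKernel m L u y ξ) := by
  set B := (n + 1) * (symbolSeminorm k L).toReal
  set J := ∫ z, ‖u z‖
  have hsm0 : AEStronglyMeasurable
      (fun y => redSymbol m L y ξ (windowFourier (wt m) u y ξ)) volume :=
    ((stronglyMeasurable_apply (stronglyMeasurable_redSymbol hk hL hB hm)
      (continuous_windowFourier_wt m u).stronglyMeasurable).comp_measurable
        measurable_prodMk_right).aestronglyMeasurable
  have hbd0 : ∀ y, ‖redSymbol m L y ξ (windowFourier (wt m) u y ξ)‖ ≤ B * (1 * J) := fun y =>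
    (redSymbol m L y ξ).le_of_opNorm_le_of_le (norm_redSymbol_le hB hm y ξ)
      (norm_windowFourier_le (abs_wt_le_one m) u y ξ)
  have I0 : ∀ g : 𝓢(Eucl n, H), Integrable fun y =>
      inner ℂ (g y) (redSymbol m L y ξ (windowFourier (wt m) u y ξ)) := fun g =>
    integrable_bilin hsm0 hbd0 g.integrable (innerBilin H)
  let K : Fin n → ℕ → Eucl n → H := fun j => leibniz (applyBilin H)
    (fun a y => redSymbolDeriv m L j a y ξ) (fun b y => windowFourier (wtSeq m j b) u y ξ)
  have hC : ∀ j, ∃ C, ∀ a ≤ 2 * m, ∀ y, ‖K j a y‖ ≤ C := fun j =>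
    (exists_norm_leibniz_le hB hm u j).imp fun C hC a ha y => hC a ha y ξ
  choose C hC using hC
  have hsm : ∀ j, ∀ a ≤ 2 * m, AEStronglyMeasurable (K j a) volume := fun j a ha =>
    ((stronglyMeasurable_leibniz hk hL hB hm u j ha).comp_measurable
      measurable_prodMk_right).aestronglyMeasurable
  have hK0 : ∀ j y, K j 0 y = redSymbol m L y ξ (windowFourier (wt m) u y ξ) := fun j y =>
    leibniz_zero _ _ _ y
  have I1 : ∀ j, Integrable fun y => inner ℂ (f y) (K j (2 * m) y) := fun j =>
    integrable_bilin (hsm j _ le_rfl) (hC j _ le_rfl) f.integrable (innerBilin H)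
  have key : ∀ j, ∫ y, inner ℂ (((∂_{(EuclideanSpace.single j (1 : ℝ) : Eucl n)})^[2 * m] f) y)
        (redSymbol m L y ξ (windowFourier (wt m) u y ξ)) =
      ∫ y, inner ℂ (f y) (K j (2 * m) y) := by
    intro j
    have h := integral_bilin_lineDerivOp_iterate (v := EuclideanSpace.single j (1 : ℝ))
      (innerBilin H) f (2 * m) (hsm j) (hC j) (fun a ha y => hasLineDerivAt_leibniz _ ha
        (fun a ha y => hasLineDerivAt_redSymbolDeriv hL hm j ha y ξ)
        (fun b _ y => hasLineDerivAt_windowFourier_wtSeq m j b u y ξ) y)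
    simpa only [innerBilin_apply, (even_two_mul m).neg_one_pow, one_smul, hK0] using h
  -- `ellipConst` is real, so it leaves either slot of the inner product without conjugation.
  have hre : ∀ (c : ℝ) (x y : H), inner ℂ (c • x) y = c • inner ℂ x y := fun c x y =>
    inner_smul_left_eq_smul x y c
  have hre' : ∀ (c : ℝ) (x y : H), inner ℂ x (c • y) = c • inner ℂ x y := fun c x y =>
    inner_smul_right_eq_smul x y c
  calc ∫ y, inner ℂ (ellipOp m f y) (redSymbol m L y ξ (windowFourier (wt m) u y ξ))
      = ∫ y, (inner ℂ (f y) (redSymbol m L y ξ (windowFourier (wt m) u y ξ)) +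
        ∑ j, ellipConst m • inner ℂ (((∂_{(EuclideanSpace.single j (1 : ℝ) : Eucl n)})^[2 * m] f) y)
          (redSymbol m L y ξ (windowFourier (wt m) u y ξ))) := by
        simp only [ellipOp_apply, inner_add_left, sum_inner, hre]
    _ = (∫ y, inner ℂ (f y) (redSymbol m L y ξ (windowFourier (wt m) u y ξ))) +
        ∑ j, ellipConst m • ∫ y, inner ℂ (f y) (K j (2 * m) y) := by
        rw [integral_add (I0 f) (integrable_finsetSum _ fun i _ => (I0 _).fun_smul _),
          integral_finsetSum _ fun i _ => (I0 _).fun_smul _]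
        simp only [integral_smul, key]
    _ = ∫ y, (inner ℂ (f y) (redSymbol m L y ξ (windowFourier (wt m) u y ξ)) +
        ∑ j, ellipConst m • inner ℂ (f y) (K j (2 * m) y)) := by
        rw [integral_add (I0 f) (integrable_finsetSum _ fun i _ => (I1 i).fun_smul _),
          integral_finsetSum _ fun i _ => (I1 i).fun_smul _]
        simp only [integral_smul]
    _ = _ := by
        simp only [redKernel, inner_add_right, inner_sum, hre', K]

end Pairing

/-! ### The bilinear estimate on phase space. -/

section Duality

variable {n : ℕ} {H : Type*} [NormedAddCommGroup H] [InnerProductSpace ℂ H]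

variable {k m : ℕ} {L : Eucl n → Eucl n → (H →L[ℂ] H)}

/-- The Schwartz function `y ↦ ∫ e^{2πi y·η} G(η) v̂(η + ξ) dη`, where `G = wt m`. -/
def dualWindow (m : ℕ) (v : 𝓢(Eucl n, H)) (ξ : Eucl n) : 𝓢(Eucl n, H) :=
  𝓕⁻ (mulTrans (wt m) (𝓕 v) ξ)

lemma ellipOp_dualWindow [CompleteSpace H] (m : ℕ) (v : 𝓢(Eucl n, H)) (y ξ : Eucl n) :
    ellipOp m (dualWindow m v ξ) y = 𝐞 (-⟪y, ξ⟫) • v y := by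
  rw [dualWindow, mulTrans, ellipOp_fourierInv, fourierInv_translate]

lemma ellipOp_fourier_mulTrans (m : ℕ) (u : 𝓢(Eucl n, H)) (y ξ : Eucl n) :
    ellipOp m (𝓕 (mulTrans (wt m) u y)) ξ = 𝐞 ⟪y, ξ⟫ • 𝓕 u ξ := by
  rw [mulTrans, ellipOp_fourier, fourier_translate]

lemma dualWindow_apply (m : ℕ) (v : 𝓢(Eucl n, H)) (y ξ : Eucl n) :
    dualWindow m v ξ y = 𝐞 ⟪ξ, -y⟫ • windowFourier (wt m) (𝓕 v : 𝓢(Eucl n, H)) ξ (-y) := by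
  rw [← fourier_mulTrans (hasTemperateGrowth_wt m), dualWindow, SchwartzMap.fourierInv_coe,
    Real.fourierInv_eq_fourier_neg, SchwartzMap.fourier_coe]

lemma continuous_dualWindow (m : ℕ) (v : 𝓢(Eucl n, H)) :
    Continuous fun p : Eucl n × Eucl n => dualWindow m v p.2 p.1 := by
  simp_rw [dualWindow_apply]
  have h1 : Continuous fun p : Eucl n × Eucl n =>
      windowFourier (wt m) (𝓕 v : 𝓢(Eucl n, H)) p.2 (-p.1) :=
    (continuous_windowFourier_wt m (𝓕 v)).comp (f := fun p : Eucl n × Eucl n => (p.2, -p.1))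
      (by fun_prop)
  fun_prop

/-- Up to a unimodular factor this is the windowed transform of 𝓕v at (ξ, -y), and (y, ξ) ↦ (ξ, -y)
preserves the measure. -/
lemma eLpNorm_dualWindow [CompleteSpace H] (m : ℕ) (v : 𝓢(Eucl n, H)) :
    eLpNorm (fun p : Eucl n × Eucl n => dualWindow m v p.2 p.1) 2 (volume.prod volume) =
      eLpNorm (wt m : Eucl n → ℝ) 2 volume * eLpNorm v 2 volume := by
  rw [← eLpNorm_fourier v, ← eLpNorm_windowFourier (hasTemperateGrowth_wt m) (abs_wt_le_one m)]
  have hmp : MeasurePreserving (fun p : Eucl n × Eucl n => (p.2, -p.1))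
      (volume.prod volume) (volume.prod volume) :=
    ((MeasurePreserving.id volume).prod (Measure.measurePreserving_neg volume)).comp
      Measure.measurePreserving_swap
  rw [← eLpNorm_comp_measurePreserving
    (continuous_windowFourier_wt m (𝓕 v)).aestronglyMeasurable hmp]
  refine eLpNorm_congr_norm_ae (.of_forall fun p => ?_)
  rw [dualWindow_apply, Circle.norm_smul]
  rfl

lemma map_circle_smul (A : H →L[ℂ] H) (c : Circle) (x : H) : A (c • x) = c • A x := by
  simp only [Circle.smul_def, map_smul]

lemma inner_circle_smul (t : ℝ) (x y : H) : inner ℂ x (𝐞 t • y) = inner ℂ (𝐞 (-t) • x) y := by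
  rw [Circle.smul_def, Circle.smul_def, inner_smul_left, inner_smul_right, AddChar.map_neg_eq_inv,
    Circle.coe_inv_eq_conj, Complex.conj_conj]

/-- Decay of order n + 1 makes the ξ-integral converge, and the polynomial growth in y is absorbed
by v. -/
lemma integrable_inner_redSymbol (hk : 0 < k) (hL : MixedPartialsExist k L)
    (hB : symbolSeminorm k L < ∞) (hm : 2 * m ≤ k) (u v : 𝓢(Eucl n, H)) :
    Integrable (fun p : Eucl n × Eucl n =>
      inner ℂ (v p.1) (redSymbol m L p.1 p.2 (𝓕 (mulTrans (wt m) u p.1) p.2)))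
      (volume.prod volume) := by
  set B := (n + 1) * (symbolSeminorm k L).toReal
  obtain ⟨C, l, hC, hdec⟩ := exists_norm_fourier_mulTrans_le (wt m) u (n + 1)
  have hv : Integrable fun y : Eucl n => (1 + ‖y‖) ^ l * ‖v y‖ := by
    have h1 : ∀ i ∈ Finset.range (l + 1), Integrable fun y : Eucl n =>
        (l.choose i : ℝ) * (‖y‖ ^ i * ‖v y‖) := fun i _ => (v.integrable_pow_mul volume i).const_mul _
    refine (integrable_finsetSum _ h1).congr (.of_forall fun y => ?_)
    simp only [add_comm (1 : ℝ), add_pow, one_pow, mul_one, Finset.sum_mul]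
    exact Finset.sum_congr rfl fun i _ => by ring
  have hξ : Integrable fun ξ : Eucl n => (1 + ‖ξ‖) ^ (-((n + 1 : ℕ) : ℝ)) :=
    integrable_one_add_norm (by rw [finrank_euclideanSpace_fin]; push_cast; linarith)
  refine ((hv.mul_prod hξ).const_mul (B * C)).mono' ?_ (.of_forall fun p => ?_)
  · have h1 : Continuous fun p : Eucl n × Eucl n => 𝓕 (mulTrans (wt m) u p.1) p.2 := by
      simp_rw [fourier_mulTrans (hasTemperateGrowth_wt m)]
      have := continuous_windowFourier_wt m u
      fun_prop
    exact ((v.continuous.comp continuous_fst).stronglyMeasurable.inner (stronglyMeasurable_apply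
      (stronglyMeasurable_redSymbol hk hL hB hm) h1.stronglyMeasurable)).aestronglyMeasurable
  · refine (norm_inner_le_norm _ _).trans ?_
    have h1 : ‖𝓕 (mulTrans (wt m) u p.1) p.2‖ ≤
        C * (1 + ‖p.1‖) ^ l * (1 + ‖p.2‖) ^ (-((n + 1 : ℕ) : ℝ)) := by
      rw [Real.rpow_neg (by positivity), Real.rpow_natCast, ← div_eq_mul_inv,
        le_div_iff₀ (by positivity), mul_comm]
      exact hdec p.1 p.2
    calc _ ≤ ‖v p.1‖ * (B * (C * (1 + ‖p.1‖) ^ l * (1 + ‖p.2‖) ^ (-((n + 1 : ℕ) : ℝ)))) := by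
          gcongr
          exact (redSymbol m L p.1 p.2).le_of_opNorm_le_of_le (norm_redSymbol_le hB hm _ _) h1
      _ = _ := by ring

lemma integral_inner_symbol [CompleteSpace H] (hk : 0 < k) (hL : MixedPartialsExist k L)
    (hB : symbolSeminorm k L < ∞) (hm : 2 * m ≤ k) (u v : 𝓢(Eucl n, H)) :
    ∫ y, inner ℂ (v y) (∫ ξ, L y ((2 * Real.pi) • ξ) (𝐞 ⟪y, ξ⟫ • 𝓕 u ξ)) =
      ∫ ξ, ∫ y, inner ℂ (dualWindow m v ξ y) (redKernel m L u y ξ) := by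
  calc ∫ y, inner ℂ (v y) (∫ ξ, L y ((2 * Real.pi) • ξ) (𝐞 ⟪y, ξ⟫ • 𝓕 u ξ))
      = ∫ y, ∫ ξ, inner ℂ (v y) (redSymbol m L y ξ (𝓕 (mulTrans (wt m) u y) ξ)) := by
        refine integral_congr_ae (.of_forall fun y => ?_)
        simp only [← ellipOp_fourier_mulTrans m u y]
        rw [integral_symbol_ellipOp hk hL hB hm, integral_inner]
        exact integrable_bilin (((stronglyMeasurable_redSymbol hk hL hB hm).comp_measurable
          measurable_prodMk_left).aestronglyMeasurable) (norm_redSymbol_le hB hm y)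
          (SchwartzMap.integrable _) (applyBilin H)
    _ = ∫ ξ, ∫ y, inner ℂ (v y) (redSymbol m L y ξ (𝓕 (mulTrans (wt m) u y) ξ)) :=
        integral_integral_swap (integrable_inner_redSymbol hk hL hB hm u v)
    _ = ∫ ξ, ∫ y, inner ℂ (ellipOp m (dualWindow m v ξ) y)
          (redSymbol m L y ξ (windowFourier (wt m) u y ξ)) := by
        -- The phase e^{2πi y·ξ} commutes with the symbol and passes to v as its conjugate, where it
        -- is absorbed into `dualWindow`.
        simp only [fourier_mulTrans (hasTemperateGrowth_wt m), map_circle_smul, inner_circle_smul,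
          ellipOp_dualWindow]
    _ = _ := by simp only [integral_inner_ellipOp hk hL hB hm]

/-- Cauchy–Schwarz on ℝⁿ × ℝⁿ, between `dualWindow` and `redKernel`. -/
lemma enorm_integral_inner_symbol_le [CompleteSpace H] (hk : 0 < k) (hL : MixedPartialsExist k L)
    (hB : symbolSeminorm k L < ∞) (hm : 2 * m ≤ k) (u v : 𝓢(Eucl n, H)) :
    ‖∫ y, inner ℂ (v y) (∫ ξ, L y ((2 * Real.pi) • ξ) (𝐞 ⟪y, ξ⟫ • 𝓕 u ξ))‖ₑ ≤
      eLpNorm (wt m : Eucl n → ℝ) 2 volume * eLpNorm v 2 volume *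
        (ENNReal.ofReal ((n + 1) * (symbolSeminorm k L).toReal) *
        (kernelConst n m * eLpNorm u 2 volume)) := by
  have hΘ := (continuous_dualWindow m v).stronglyMeasurable
  have hK := stronglyMeasurable_redKernel hk hL hB hm u
  rw [integral_inner_symbol hk hL hB hm]
  calc _ ≤ ∫⁻ ξ, ∫⁻ y, ‖inner ℂ (dualWindow m v ξ y) (redKernel m L u y ξ)‖ₑ :=
        (enorm_integral_le_lintegral_enorm _).trans
          (lintegral_mono fun ξ => enorm_integral_le_lintegral_enorm _)
    _ = ∫⁻ p : Eucl n × Eucl n, ‖inner ℂ (dualWindow m v p.2 p.1) (redKernel m L u p.1 p.2)‖ₑ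
          ∂(volume.prod volume) :=
        (lintegral_prod_symm _ (hΘ.inner hK).enorm.aemeasurable).symm
    _ = eLpNorm (fun p : Eucl n × Eucl n =>
          inner ℂ (dualWindow m v p.2 p.1) (redKernel m L u p.1 p.2)) 1 (volume.prod volume) :=
        (eLpNorm_one_eq_lintegral_enorm).symm
    _ ≤ eLpNorm (fun p : Eucl n × Eucl n => dualWindow m v p.2 p.1) 2 (volume.prod volume) *
        eLpNorm (fun p : Eucl n × Eucl n => redKernel m L u p.1 p.2) 2 (volume.prod volume) := by
        have := eLpNorm_le_eLpNorm_mul_eLpNorm_of_nnnorm (p := 2) (q := 2) (r := 1)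
          hΘ.aestronglyMeasurable hK.aestronglyMeasurable (fun x y : H => (inner ℂ x y : ℂ)) 1
          (μ := volume.prod volume) (.of_forall fun p => by
            rw [one_mul]; exact nnnorm_inner_le_nnnorm _ _)
        simpa using this
    _ ≤ _ := by
        rw [eLpNorm_dualWindow]
        gcongr
        exact eLpNorm_redKernel_le hk hL hB hm u

end Duality

/-! ### From the bilinear estimate to the L² bound for the operator. -/

section Boundedness

variable {n : ℕ} {H : Type*} [NormedAddCommGroup H] [InnerProductSpace ℂ H]

/-- L² duality without knowing f ∈ L² beforehand: pairing with f extends to a bounded functional on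
L², Riesz represents it by some w, and f = w almost everywhere. Boundedness of f makes the pairings
converge. -/
lemma eLpNorm_le_of_forall_schwartz [CompleteSpace H] {f : Eucl n → H}
    (hf : AEStronglyMeasurable f volume) {C : ℝ} (hC : ∀ y, ‖f y‖ ≤ C) {K : ℝ} (hK0 : 0 ≤ K)
    (hK : ∀ v : 𝓢(Eucl n, H), ‖∫ y, inner ℂ (v y) (f y)‖ ≤ K * ‖v.toLp 2 volume‖) :
    eLpNorm f 2 volume ≤ ENNReal.ofReal K := by
  have hint : ∀ v : 𝓢(Eucl n, H), Integrable fun y => inner ℂ (f y) (v y) := fun v =>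
    integrable_bilin hf hC v.integrable (innerBilin H).flip
  let φ : 𝓢(Eucl n, H) →ₗ[ℂ] ℂ :=
    { toFun := fun v => ∫ y, inner ℂ (f y) (v y)
      map_add' := fun v w => by
        rw [← integral_add (hint v) (hint w)]
        simp only [add_apply, inner_add_right]
      map_smul' := fun c v => by
        simp only [smul_apply, inner_smul_right, RingHom.id_apply, smul_eq_mul, integral_const_mul] }
  let e : 𝓢(Eucl n, H) →ₗ[ℂ] Lp H 2 (volume : Measure (Eucl n)) :=
    (SchwartzMap.toLpCLM ℂ H 2 volume).toLinearMap
  have he : DenseRange e := SchwartzMap.denseRange_toLpCLM (by simp)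
  have hφ : ∀ v, ‖φ v‖ ≤ K * ‖e v‖ := fun v => by
    have : φ v = star (∫ y, inner ℂ (v y) (f y)) := by
      change ∫ y, inner ℂ (f y) (v y) = (starRingEnd ℂ) (∫ y, inner ℂ (v y) (f y))
      rw [← integral_conj]
      simp only [inner_conj_symm]
    rw [this, norm_star]
    exact hK v
  let w := (InnerProductSpace.toDual ℂ (Lp H 2 (volume : Measure (Eucl n)))).symm
    (φ.extendOfNorm e)
  have hw : ∀ v : 𝓢(Eucl n, H), ∫ y, inner ℂ (w y) (v y) = ∫ y, inner ℂ (f y) (v y) := by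
    intro v
    have h1 : inner ℂ w (e v) = φ v := by
      rw [InnerProductSpace.toDual_symm_apply]
      exact LinearMap.extendOfNorm_eq he ⟨K, hφ⟩ v
    rw [L2.inner_def] at h1
    refine Eq.trans (integral_congr_ae ?_) h1
    filter_upwards [v.coeFn_toLp 2 volume] with y hy
    rw [← hy]
    rfl
  have hwK : ‖w‖ ≤ K := by
    rw [LinearIsometryEquiv.norm_map]
    exact ContinuousLinearMap.opNorm_le_bound _ hK0
      (LinearMap.norm_extendOfNorm_apply_le he K hφ)
  have hwl : LocallyIntegrable w volume := (Lp.memLp w).locallyIntegrable one_le_two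
  have hfl : LocallyIntegrable f volume :=
    (memLp_top_of_bound hf C (.of_forall hC)).locallyIntegrable le_top
  have hae : ∀ᵐ y, f y = w y := by
    -- The identity `hw` is tested on g(y) a, with g smooth of compact support and a ∈ H arbitrary.
    refine ae_eq_of_integral_contDiff_smul_eq hfl hwl fun g hg hgc => ?_
    have hgf := hfl.integrable_smul_left_of_hasCompactSupport hg.continuous hgc
    have hgw := hwl.integrable_smul_left_of_hasCompactSupport hg.continuous hgc
    refine ext_inner_right ℂ fun a => ?_
    have h1 : ContDiff ℝ ((⊤ : ℕ∞) : WithTop ℕ∞) fun y => g y • a := hg.smul contDiff_const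
    have h2 : HasCompactSupport fun y => g y • a := hgc.smul_right
    have h3 := hw (h2.toSchwartzMap h1)
    have hflip : ∀ {q : Eucl n → H}, Integrable (fun y => g y • q y) →
        inner ℂ (∫ y, g y • q y) a = ∫ y, inner ℂ (q y) ((h2.toSchwartzMap h1) y) := by
      intro q hq
      rw [← inner_conj_symm, ← integral_inner hq, ← integral_conj]
      refine integral_congr_ae (.of_forall fun y => ?_)
      simp only [inner_conj_symm]
      change inner ℂ (g y • q y) a = inner ℂ (q y) (g y • a)
      rw [inner_smul_left_eq_smul, inner_smul_right_eq_smul]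
    rw [hflip hgf, hflip hgw, h3]
  rw [eLpNorm_congr_ae hae, ← ENNReal.ofReal_toReal (Lp.eLpNorm_ne_top w), ← Lp.norm_def]
  exact ENNReal.ofReal_le_ofReal hwK

lemma fourierHat_eq (u : 𝓢(Eucl n, H)) (ξ : Eucl n) :
    fourierHat u ((2 * Real.pi) • ξ) = 𝓕 u ξ := by
  rw [SchwartzMap.fourier_coe, Real.fourier_eq, fourierHat]
  refine integral_congr_ae (.of_forall fun y => ?_)
  simp only [Circle.smul_def, Real.fourierChar_apply]
  congr 2
  rw [real_inner_smul_left, real_inner_comm]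
  push_cast
  ring

lemma opIntegrand_dilation (L : Eucl n → Eucl n → (H →L[ℂ] H)) (u : 𝓢(Eucl n, H))
    (y ξ : Eucl n) : opIntegrand L u y ((2 * Real.pi) • ξ) =
      L y ((2 * Real.pi) • ξ) (𝐞 ⟪y, ξ⟫ • 𝓕 u ξ) := by
  rw [map_circle_smul, ← fourierHat_eq, opIntegrand, Circle.smul_def, Real.fourierChar_apply]
  congr 2
  rw [real_inner_smul_right]
  push_cast
  ring

/-- The Jacobian of η = 2πξ absorbs the factor (2π)^{-n}. -/
lemma Op_eq (L : Eucl n → Eucl n → (H →L[ℂ] H)) (u : 𝓢(Eucl n, H)) (y : Eucl n) :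
    Op L u y = ∫ ξ, L y ((2 * Real.pi) • ξ) (𝐞 ⟪y, ξ⟫ • 𝓕 u ξ) := by
  simp only [← opIntegrand_dilation]
  rw [Measure.integral_comp_smul, finrank_euclideanSpace_fin, Op, abs_of_pos (by positivity)]

variable {k m : ℕ} {L : Eucl n → Eucl n → (H →L[ℂ] H)}

lemma stronglyMeasurable_dilated_integrand (hk : 0 < k) (hL : MixedPartialsExist k L)
    (hB : symbolSeminorm k L < ∞) (u : 𝓢(Eucl n, H)) :
    StronglyMeasurable fun p : Eucl n × Eucl n =>
      L p.1 ((2 * Real.pi) • p.2) (𝐞 ⟪p.1, p.2⟫ • 𝓕 u p.2) := by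
  refine stronglyMeasurable_apply (stronglyMeasurable_comp_dilation
    (continuous_symbol hk hL hB).stronglyMeasurable) (Continuous.stronglyMeasurable ?_)
  have := (𝓕 u).continuous
  fun_prop

lemma integrable_dilated_integrand (hk : 0 < k) (hL : MixedPartialsExist k L)
    (hB : symbolSeminorm k L < ∞) (u : 𝓢(Eucl n, H)) (y : Eucl n) :
    Integrable fun ξ => L y ((2 * Real.pi) • ξ) (𝐞 ⟪y, ξ⟫ • 𝓕 u ξ) := by
  refine ((𝓕 u).integrable.norm.const_mul (symbolSeminorm k L).toReal).mono'
    ((stronglyMeasurable_dilated_integrand hk hL hB u).comp_measurable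
      measurable_prodMk_left).aestronglyMeasurable (.of_forall fun ξ => ?_)
  refine ((L y _).le_of_opNorm_le (norm_symbol_le hB y _) _).trans ?_
  rw [Circle.norm_smul]

lemma integrable_opIntegrand (hk : 0 < k) (hL : MixedPartialsExist k L)
    (hB : symbolSeminorm k L < ∞) (u : 𝓢(Eucl n, H)) (y : Eucl n) :
    Integrable (opIntegrand L u y) := by
  rw [← integrable_comp_smul_iff volume _ (R := 2 * Real.pi) (by positivity)]
  simp only [opIntegrand_dilation]
  exact integrable_dilated_integrand hk hL hB u y

lemma aestronglyMeasurable_Op (hk : 0 < k) (hL : MixedPartialsExist k L)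
    (hB : symbolSeminorm k L < ∞) (u : 𝓢(Eucl n, H)) : AEStronglyMeasurable (Op L u) volume := by
  have : Op L u = fun y => ∫ ξ, L y ((2 * Real.pi) • ξ) (𝐞 ⟪y, ξ⟫ • 𝓕 u ξ) := funext (Op_eq L u)
  rw [this]
  exact (stronglyMeasurable_dilated_integrand hk hL hB u).integral_prod_right.aestronglyMeasurable

lemma Op_add (hk : 0 < k) (hL : MixedPartialsExist k L) (hB : symbolSeminorm k L < ∞)
    (u v : 𝓢(Eucl n, H)) : Op L (u + v : 𝓢(Eucl n, H)) = Op L u + Op L v := by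
  funext y
  rw [Pi.add_apply, Op_eq, Op_eq, Op_eq, ← integral_add (integrable_dilated_integrand hk hL hB u y)
    (integrable_dilated_integrand hk hL hB v y)]
  simp only [FourierTransform.fourier_add, add_apply, smul_add, map_add]

lemma Op_smul (L : Eucl n → Eucl n → (H →L[ℂ] H)) (c : ℂ) (u : 𝓢(Eucl n, H)) :
    Op L (c • u : 𝓢(Eucl n, H)) = c • Op L u := by
  funext y
  rw [Pi.smul_apply, Op_eq, Op_eq, ← integral_smul]
  simp only [FourierTransform.fourier_smul, smul_apply, smul_comm _ c, map_smul]

variable (n) in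
/-- The constant in the Calderón–Vaillancourt estimate. -/
def boundConst (m : ℕ) : ℝ :=
  (eLpNorm (wt m : Eucl n → ℝ) 2 volume).toReal * (n + 1) * (kernelConst n m).toReal

lemma eLpNorm_Op_le [CompleteSpace H] (hk : 0 < k) (hL : MixedPartialsExist k L)
    (hB : symbolSeminorm k L < ∞) (hn : n < 4 * m) (hm : 2 * m ≤ k) (u : 𝓢(Eucl n, H)) :
    eLpNorm (Op L u) 2 volume ≤
      ENNReal.ofReal (boundConst n m * (symbolSeminorm k L).toReal * ‖u.toLp 2 volume‖) := by
  set B := (symbolSeminorm k L).toReal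
  have hB0 : 0 ≤ B := ENNReal.toReal_nonneg
  have h0 : 0 ≤ boundConst n m := by unfold boundConst; positivity
  refine eLpNorm_le_of_forall_schwartz (aestronglyMeasurable_Op hk hL hB u)
    (C := B * ∫ ξ, ‖𝓕 u ξ‖) (fun y => ?_) (by positivity) fun v => ?_
  · rw [Op_eq, ← integral_const_mul]
    refine norm_integral_le_of_norm_le ((𝓕 u).integrable.norm.const_mul B) (.of_forall fun ξ => ?_)
    refine ((L y _).le_of_opNorm_le (norm_symbol_le hB y _) _).trans ?_
    rw [Circle.norm_smul]
  · have h1 := enorm_integral_inner_symbol_le hk hL hB hm u v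
    simp only [← Op_eq] at h1
    change _ ≤ _ * (ENNReal.ofReal ((n + 1) * B) * _) at h1
    have h2 := ENNReal.toReal_mono (ENNReal.mul_lt_top (ENNReal.mul_lt_top (memLp_wt hn).2
      (v.eLpNorm_lt_top 2 volume)) (ENNReal.mul_lt_top ENNReal.ofReal_lt_top (ENNReal.mul_lt_top
        (kernelConst_lt_top hn) (u.eLpNorm_lt_top 2 volume)))).ne h1
    rw [toReal_enorm] at h2
    refine h2.trans (le_of_eq ?_)
    simp only [ENNReal.toReal_mul, SchwartzMap.norm_toLp, boundConst,
      ENNReal.toReal_ofReal (mul_nonneg (n.cast_add_one_pos (α := ℝ)).le hB0)]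
    ring

end Boundedness

end OpSymbol

end

/-! ### Choice of m and extension to L². -/

theorem mainTheorem5 (n : ℕ) :
    ∃ C : ℝ, 0 < C ∧
      ∀ (H : Type*) [NormedAddCommGroup H] [InnerProductSpace ℂ H] [CompleteSpace H]
        [SeparableSpace H]
        (L : OpSymbol.Eucl n → OpSymbol.Eucl n → (H →L[ℂ] H)),
        OpSymbol.MixedPartialsExist (n / 2 + 2) L →
        OpSymbol.symbolSeminorm (n / 2 + 2) L < ∞ →
        (∀ (u : 𝓢(OpSymbol.Eucl n, H)) (y : OpSymbol.Eucl n),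
          Integrable (OpSymbol.opIntegrand L u y) volume) ∧
        ∃ T : Lp H 2 (volume : Measure (OpSymbol.Eucl n)) →L[ℂ]
            Lp H 2 (volume : Measure (OpSymbol.Eucl n)),
          (∀ u : 𝓢(OpSymbol.Eucl n, H),
            T (u.toLp 2 volume) =ᵐ[volume] OpSymbol.Op L u) ∧
          ‖T‖ ≤ C * (OpSymbol.symbolSeminorm (n / 2 + 2) L).toReal := by
  -- The largest m allowed by the available derivatives, ⌊(⌊n/2⌋ + 2)/2⌋, still satisfies 4m > n.
  obtain ⟨m, hm1, hm2⟩ : ∃ m : ℕ, n < 4 * m ∧ 2 * m ≤ n / 2 + 2 :=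
    ⟨(n / 2 + 2) / 2, by omega, by omega⟩
  have h0 : 0 ≤ OpSymbol.boundConst n m := by unfold OpSymbol.boundConst; positivity
  -- Adding 1 gives strict positivity without checking that `boundConst` is nonzero.
  refine ⟨OpSymbol.boundConst n m + 1, by positivity, ?_⟩
  intro H _ _ _ _ L hL hB
  have hk : 0 < n / 2 + 2 := by omega
  refine ⟨OpSymbol.integrable_opIntegrand hk hL hB, ?_⟩
  set B := (OpSymbol.symbolSeminorm (n / 2 + 2) L).toReal
  have hB0 : 0 ≤ B := ENNReal.toReal_nonneg
  have hle := OpSymbol.eLpNorm_Op_le hk hL hB hm1 hm2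
  have hLp : ∀ u : 𝓢(OpSymbol.Eucl n, H), MemLp (OpSymbol.Op L u) 2 volume := fun u =>
    ⟨OpSymbol.aestronglyMeasurable_Op hk hL hB u, (hle u).trans_lt ENNReal.ofReal_lt_top⟩
  let A : 𝓢(OpSymbol.Eucl n, H) →ₗ[ℂ] Lp H 2 (volume : Measure (OpSymbol.Eucl n)) :=
    { toFun := fun u => (hLp u).toLp
      map_add' := fun u v => by
        rw [← MemLp.toLp_add]
        exact MemLp.toLp_congr _ _ (.of_eq (OpSymbol.Op_add hk hL hB u v))
      map_smul' := fun c u => by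
        rw [RingHom.id_apply, ← MemLp.toLp_const_smul]
        exact MemLp.toLp_congr _ _ (.of_eq (OpSymbol.Op_smul L c u)) }
  let e : 𝓢(OpSymbol.Eucl n, H) →ₗ[ℂ] Lp H 2 (volume : Measure (OpSymbol.Eucl n)) :=
    (SchwartzMap.toLpCLM ℂ H 2 volume).toLinearMap
  have he : DenseRange e := SchwartzMap.denseRange_toLpCLM (by simp)
  have hA : ∀ u, ‖A u‖ ≤ OpSymbol.boundConst n m * B * ‖e u‖ := fun u => by
    change ‖(hLp u).toLp‖ ≤ _
    rw [Lp.norm_toLp]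
    exact ENNReal.toReal_le_of_le_ofReal (by positivity) (hle u)
  refine ⟨A.extendOfNorm e, fun u => ?_, ?_⟩
  · have h1 : A.extendOfNorm e (u.toLp 2 volume) = A u :=
      LinearMap.extendOfNorm_eq he ⟨_, hA⟩ u
    rw [h1]
    exact (hLp u).coeFn_toLp
  · refine (ContinuousLinearMap.opNorm_le_bound _ (by positivity)
      (LinearMap.norm_extendOfNorm_apply_le he _ hA)).trans ?_
    exact mul_le_mul_of_nonneg_right (by linarith) hB0
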